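/- **Setting.** Let $\mathcal X,\mathcal G,\mathsf M$ be the sets of local variables, global variables and mutexes, $\mathcal V$ the set of values, $\mathcal I\subseteq\mathcal V$ the thread ids, $\mathsf{self}\in\mathcal X$ the local holding the id of the current thread. A program is a control-flow graph with edges $(u,A,u')\in\mathcal E$ and start point $u_0$, where $A$ is a guard $r$, an assignment $x=r$ ($r$ an expression over locals), $x=\mathsf{create}(u_1)$, $\mathsf{lock}(a)$, $\mathsf{unlock}(a)$, a read $x=g$ or a write $g=x$. Each access $A$ to a global $g$ occurs as $\mathsf{lock}(m_g);A;\mathsf{unlock}(m_g)$ for a mutex $m_g\in\mathsf M$ associated with $g$. *Local traces.* A node is a triple $(j,u,\sigma)$ with $j\in\mathbb N$, $u$ a program point and $\sigma:\mathcal X\to\mathcal V$; it belongs to thread $\sigma\,\mathsf{self}$. A global trace consists of a graph that is the union of finite single-thread runs with distinct thread ids (each run $\bar u_0A_1\bar u_1\dots A_n\bar u_n$ with $\bar u_j=(j,u_j,\sigma_j)$ follows the edges of the program and the local effect of their actions, with arbitrary values read from globals and arbitrary ids assigned by $\mathsf{create}$), a create order $\to_c$ and locking orders $\to_a$ ($a\in\mathsf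 M$), such that: the union of program order, $\to_c$ and all $\to_a$ is acyclic, its reflexive-transitive closure $\le$ (causality) has a least element $\mathbf 0=(0,u_0,\sigma_0)$ with $\sigma_0\,\mathsf{self}$ the initial thread id; every first node of a thread other than $\mathbf 0$ has exactly one $\to_c$-predecessor, every node has at most one $\to_c$-successor, and $z=(j,u,\sigma)\to_c(0,v,\sigma')$ implies that the program has an edge $(u,x=\mathsf{create}(v),\cdot)$, that $\sigma'$ and $\sigma$ agree except possibly at $\mathsf{self}$, and that the program-order edge of the trace leaving $z$, if there is one, is labelled $x=\mathsf{create}(v)$ for some $x$ whose value after that edge is $\sigma'\,\mathsf{self}$; $\to_a$ leads from $\mathbf 0$ or ends of $\mathsf{unlock}(a)$ edges to ends of $\mathsf{lock}(a)$ edges, each end of a $\mathsf{lock}(a)$ edge has exactly one $\to_a$-predecessor and each node at most one $\to_a$-successor; no thread locks a mutex it holds or unlocks one it does not hold; and for each read edge $x=g$ with source $\bar v$, there is a write to $g$ whose end is $\le$-maximal among the ends $\le\bar v$ of writes to $g$, and the read yields its value. A local trace $t$ is a global trace with a greatest node, its sink; the thread of the sink is the ego thread, and $\mathsf{loc}(t)$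 and $t(x)$ are the program point and the value of $x$ at the sink; $\mathsf{last}(t)$ is the last action of the ego thread. *Operations and semantics.* Let $\mathsf{init}$ be the set of one-node local traces at $u_0$ with the initial thread id and arbitrary other locals, and let $\nu$ assign to each trace an id for a thread created at its end. $\mathsf{new}\,u_1\,t$ is the set of (at most one) local traces extending $t$ by a new thread starting at $u_1$ with id $\nu(t)$ and otherwise the locals of the sink of $t$, created at the sink of $t$; for $e=(u,A,u')$, $[\![e]\!](t_0)$ (and $[\![e]\!](t_0,t_1)$ for $A=\mathsf{lock}(a)$, where $t_1\in\mathsf{init}$ or $\mathsf{last}(t_1)=\mathsf{unlock}(a)$) is the set of local traces obtained by extending $t_0$ (merged with $t_1$, where the sink of $t_1$ becomes the $\to_a$-predecessor of the new sink) by executing $e$ at the sink of $t_0$ (which lies at $u$); $x=\mathsf{create}(u_1)$ assigns $\nu(t_0)$ to $x$. $\mathcal T$ is the least set of traces containing $\mathsf{init}$ and closed under all these operations. The local trace semantics $\eta$ is the least solution of the constraint system $\mathcal C$ over unknowns $[u]$, $[a]$ with sets of traces as values: $[u_0]\supseteq\mathsf{init}$, $[a]\supseteq\mathsf{init}$, and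 for each edge $e=(u,A,u')$: $[u']\supseteq[\![e]\!](\eta[u])$ (for $A=\mathsf{lock}(a)$: $[u']\supseteq[\![e]\!](\eta[u],\eta[a])$), where $\mathsf{unlock}(a)$ additionally contributes $[\![e]\!](\eta[u])$ to $[a]$ and $x=\mathsf{create}(u_1)$ contributes $\mathsf{new}\,u_1\,(\eta[u])$ to $[u_1]$. *The analysis.* Let $\mathcal D$ be a complete lattice with monotone concretization $\gamma_{\mathcal D}:\mathcal D\to2^{\mathcal V}$, $\gamma_{\mathcal D}(\top)=\mathcal V$, with sound abstract evaluation $[\![r]\!]^\sharp$ of expressions, sound abstract guards, and abstract thread ids $\nu^\sharp$ which are sound: $\nu(t)\in\gamma_{\mathcal D}(\nu^\sharp\,u\,s\,u_1)$ whenever a $\mathsf{create}(u_1)$ edge leaves $u$ and $t\in\gamma_{u,S}(s)$ for some $S$ (see below). The system $\mathcal C_2$ (Lock-Centered Reading) has unknowns $[g,a,S]$ with values in $\mathcal D$ and $[u,S]$ ($S\subseteq\mathsf M$) whose values are triples $(V,L,\sigma)$: $V:\mathsf M\to2^{\mathcal G}$ (ordered by $\supseteq$), $L$ mapping mutexes to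 upward-closed sets of locksets (ordered by $\subseteq$; $\{S\}$ denotes the upward closure), $\sigma:\mathcal X\cup\mathcal G\to\mathcal D$. Its constraints are: $[u_0,\emptyset]\sqsupseteq(a\mapsto\emptyset,\;a\mapsto\emptyset,\;\{x\mapsto\top\}\cup\{g\mapsto\bot\})$, and, for each edge $(u,A,u')$ and each $S$, with $(V,L,\sigma)=\eta_2[u,S]$, the constraint $[u',S']\sqsupseteq s$ (where $S'=S\cup\{a\}$ for $A=\mathsf{lock}(a)$, $S'=S\setminus\{a\}$ for $A=\mathsf{unlock}(a)$, and $S'=S$ otherwise) with - guard $r$, assignment $x=r$: $s=(V,L,\sigma')$ with $\sigma'$ the abstract guard applied to $\sigma$, resp. $\sigma\oplus\{x\mapsto[\![r]\!]^\sharp\sigma\}$; - $x=\mathsf{create}(u_1)$: with $i=\nu^\sharp\,u\,(V,L,\sigma)\,u_1$, $s=(V,L,\sigma\oplus\{x\mapsto i\})$, and the side-effect $[u_1,\emptyset]\sqsupseteq(a\mapsto\emptyset,\;a\mapsto\emptyset,\;\sigma\oplus(\{\mathsf{self}\mapsto i\}\cup\{g\mapsto\bot\mid g\in\mathcal G\}))$;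 - $\mathsf{lock}(a)$: $s=(V\oplus\{a\mapsto\emptyset\},L\oplus\{a\mapsto\{S\}\},\sigma)$; - $\mathsf{unlock}(a)$: $s=(V,L,\sigma)$, and the side-effects $[g,a,S\setminus\{a\}]\sqsupseteq\sigma\,g$ for all $g\in\mathcal G$; - $g=x$: $s=(\{a\mapsto V\,a\cup\{g\}\},L,\sigma\oplus\{g\mapsto\sigma\,x\})$; - $x=g$: $s=(V,L,\sigma\oplus\{x\mapsto\sigma\,g\sqcup d\})$ with $d=\bigsqcup\{\eta_2[g,a,S']\mid a\in\mathsf M,\ g\notin V\,a,\ B\in L\,a,\ B\cap S'=\emptyset\}$. A post-solution is an assignment $\eta_2$ of the unknowns that satisfies all constraints and side-effects. *Concretization.* For a local trace $t$ let $\beta\,t=(V,L,\sigma)$, where $V\,a$ is the set of globals written by the ego thread since it last acquired $a$ (since its start, if it never acquired $a$), $L\,a=\{B\}$ for the lockset $B$ held by the ego thread just before its last $\mathsf{lock}(a)$ and $L\,a=\emptyset$ if there is none, $\sigma\,x=\{t(x)\}$ for locals $x$, and $\sigma\,g$ contains just the value of the ego thread's last write to $g$, if any. Let $\mathcal T_S$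 be the set of $t\in\mathcal T$ with lockset $S$ held by the ego thread at the sink. Then $\gamma_{u,S}(V^\sharp,L^\sharp,\sigma^\sharp)$ is the set of $t\in\mathcal T_S$ with $\mathsf{loc}(t)=u$, $\beta\,t=(V,L,\sigma)$, $V\sqsubseteq V^\sharp$, $L\sqsubseteq L^\sharp$ and $\sigma\subseteq\gamma_{\mathcal D}\circ\sigma^\sharp$ pointwise; and $\gamma_{g,a,S}(d)$ is the set of $t\in\mathcal T_S$ with $\mathsf{last}(t)=\mathsf{unlock}(a)$ such that the ego thread has not written $g$ or the value of its last write to $g$ lies in $\gamma_{\mathcal D}(d)$. **Theorem.** The system $\mathcal C$ has a least solution $\eta$, and: 1. Every post-solution $\eta_2$ of $\mathcal C_2$ is sound w.r.t. the local trace semantics: for all $u,g,a,S$, every trace in $\eta[u]$ at whose sink the ego thread holds the lockset $S$ is in $\gamma_{u,S}(\eta_2[u,S])$, and every trace in $\eta[a]$ at whose sink the ego thread holds the lockset $S$ is in $\mathsf{init}\cup\gamma_{g,a,S}(\eta_2[g,a,S])$. 2. Let $t\in\eta[u]$ with $\mathsf{last}(t)$ a read $x=g$, and let $V,L$ be the first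 two components of $\beta\,t$. Then $t$ has a last write to $g$ (with respect to $\le$), $t(x)$ is the value it writes, and this write either is the ego thread's last write to $g$ in $t$, or is the last write to $g$ by the ego thread of some trace $t'\in\eta[a]$ at whose sink that thread holds a lockset $S'$, where $L\,a=\{B\}$ (so $a$ was acquired by the ego thread of $t$), $B\cap S'=\emptyset$ and $g\notin V\,a$. -/

import Mathlib

universe u

namespace LockCentered

/-! ### Side-effecting constraint systems -/

/-- A side-effecting constraint `x ⊒ f_x`. The right-hand side maps an assignment of the unknowns to
the collection of its side-effects (`⊥` at the unknowns without side-effect), together with its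
contribution to the left-hand side. -/
structure SEConstraint {Un : Type u} (Dom : Un → Type u) where
  lhs : Un
  rhs : (∀ x, Dom x) → (∀ x, Dom x) × Dom lhs

/-- `η` is a (post-)solution: all side-effects and all contributions are accounted for by `η`. -/
def IsPostSolution {Un : Type u} {Dom : Un → Type u} [∀ x, CompleteLattice (Dom x)]
    (C : Set (SEConstraint Dom)) (η : ∀ x, Dom x) : Prop :=
  ∀ c ∈ C, (c.rhs η).1 ≤ η ∧ (c.rhs η).2 ≤ η c.lhs

open Classical in
/-- The collection of side-effects consisting of the single side-effect `x ↦ d`. -/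
noncomputable def effect {Un : Type u} {Dom : Un → Type u} [∀ x, CompleteLattice (Dom x)]
    (x : Un) (d : Dom x) : ∀ y, Dom y :=
  Function.update ⊥ x d

/-! ### Programs and local traces -/

/-- Actions: guards, assignments `x = r` to locals, `x = create(u₁)`, `lock(a)`, `unlock(a)`, reads
`x = g` and writes `g = x` of globals. -/
inductive Action (N X G M Ex : Type u) : Type u
  | guard (r : Ex)
  | assign (x : X) (r : Ex)
  | create (x : X) (u₁ : N)
  | lock (a : M)
  | unlock (a : M)
  | read (x : X) (g : G)
  | write (g : G) (x : X)

/-- A node `(j, u, σ)`. -/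
@[ext]
structure Node (N X Val : Type u) : Type u where
  idx : ℕ
  pt : N
  st : X → Val

/-- The data of a local trace: a graph of nodes and labelled program-order edges, the create order,
the locking orders, and the distinguished node at which the trace ends. -/
@[ext]
structure Trace (N X G M Ex Val : Type u) : Type u where
  nodes : Set (Node N X Val)
  acts : Set (Node N X Val × Action N X G M Ex × Node N X Val)
  cr : Node N X Val → Node N X Val → Prop
  lk : M → Node N X Val → Node N X Val → Prop
  sink : Node N X Val

/-- A program (control-flow graph) with values, thread ids, expression evaluation, the mutex `m_g`
of each global `g`, and the function `ν` providing the ids of created threads. -/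
structure Program (N X G M Ex Val : Type u) : Type u where
  edges : Set (N × Action N X G M Ex × N)
  start : N
  self : X
  ids : Set Val
  tid0 : Val
  tid0_mem : tid0 ∈ ids
  /-- the value encoding *false* -/
  zero : Val
  eval : Ex → (X → Val) → Val
  mutexOf : G → M
  nu : Trace N X G M Ex Val → Val
  nu_mem : ∀ t, nu t ∈ ids

/-- The action reads or writes the global `g`. -/
def Action.Accesses {N X G M Ex : Type u} (A : Action N X G M Ex) (g : G) : Prop :=
  (∃ x, A = .read x g) ∨ (∃ x, A = .write g x)

/-- A finite sequence `ū₀ A₀ ū₁ … A_{len-1} ū_len`; entries beyond `len` are irrelevant. -/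
structure RawTrace (N X G M Ex Val : Type u) : Type u where
  len : ℕ
  pt : ℕ → N
  st : ℕ → X → Val
  act : ℕ → Action N X G M Ex

section

variable {N X G M Ex Val : Type u}

def RawTrace.node (ρ : RawTrace N X G M Ex Val) (j : ℕ) : Node N X Val := ⟨j, ρ.pt j, ρ.st j⟩

def RawTrace.nodes (ρ : RawTrace N X G M Ex Val) : Set (Node N X Val) :=
  {v | ∃ j ≤ ρ.len, v = ρ.node j}

def RawTrace.acts (ρ : RawTrace N X G M Ex Val) :
    Set (Node N X Val × Action N X G M Ex × Node N X Val) :=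
  {e | ∃ j < ρ.len, e = (ρ.node j, ρ.act j, ρ.node (j + 1))}

namespace Program

variable (P : Program N X G M Ex Val)

/-- Each access to a global `g` occurs as `lock(m_g); A; unlock(m_g)`. -/
def AtomicAccesses : Prop :=
  ∀ u A u' g, (u, A, u') ∈ P.edges → A.Accesses g →
    u ≠ P.start ∧
    (∀ v x v', (v, Action.create x u, v') ∉ P.edges) ∧
    (∀ v B, (v, B, u) ∈ P.edges → B = .lock (P.mutexOf g)) ∧
    (∀ B v, (u', B, v) ∈ P.edges → B = .unlock (P.mutexOf g))

open Classical in
/-- Local state transitions of one thread; reads and thread creation are unconstrained here up to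
the shape of the resulting state. -/
def Step : Action N X G M Ex → (X → Val) → (X → Val) → Prop
  | .guard r, σ, σ' => P.eval r σ ≠ P.zero ∧ σ' = σ
  | .assign x r, σ, σ' => σ' = Function.update σ x (P.eval r σ)
  | .create x _, σ, σ' => ∃ i ∈ P.ids, σ' = Function.update σ x i
  | .lock _, σ, σ' => σ' = σ
  | .unlock _, σ, σ' => σ' = σ
  | .read x _, σ, σ' => ∃ d, σ' = Function.update σ x d
  | .write _ _, σ, σ' => σ' = σ

/-- `ρ` is a raw trace of the single thread with id `i`. -/
def IsRaw (i : Val) (ρ : RawTrace N X G M Ex Val) : Prop :=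
  (∀ j ≤ ρ.len, ρ.st j P.self = i) ∧
  ∀ j < ρ.len, (ρ.pt j, ρ.act j, ρ.pt (j + 1)) ∈ P.edges ∧
    P.Step (ρ.act j) (ρ.st j) (ρ.st (j + 1))

/-- The id of the thread to which a node belongs. -/
def tid (v : Node N X Val) : Val := v.st P.self

/-- Nodes of the form `(0, u₀, σ₀)` with `σ₀ self = 0`. -/
def IsRoot (v : Node N X Val) : Prop := v.idx = 0 ∧ v.pt = P.start ∧ P.tid v = P.tid0

end Program

namespace Trace

variable (t : Trace N X G M Ex Val)

/-- The union of the program order, the create order and the locking orders. -/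
def Imm (v w : Node N X Val) : Prop :=
  (∃ A, (v, A, w) ∈ t.acts) ∨ t.cr v w ∨ ∃ a, t.lk a v w

/-- The causality order. -/
def Le : Node N X Val → Node N X Val → Prop := Relation.ReflTransGen t.Imm

/-- `last_write_g t = (w, g = y, w')`. -/
def IsLastWrite (g : G) (w : Node N X Val) (y : X) (w' : Node N X Val) : Prop :=
  (w, Action.write g y, w') ∈ t.acts ∧
  ∀ z y' z', (z, Action.write g y', z') ∈ t.acts → t.Le z' w'

/-- The last action of the ego thread is `A`. -/
def LastIs (A : Action N X G M Ex) : Prop := ∃ v, (v, A, t.sink) ∈ t.acts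

end Trace

namespace Program

variable (P : Program N X G M Ex Val) (t : Trace N X G M Ex Val)

/-- The mutexes which the thread of `v` has acquired and, at `v`, not yet released. -/
def lockset (v : Node N X Val) : Set M :=
  {a | ∃ w w', (w, Action.lock a, w') ∈ t.acts ∧ P.tid w' = P.tid v ∧ w'.idx ≤ v.idx ∧
    ∀ z z', (z, Action.unlock a, z') ∈ t.acts → P.tid z' = P.tid v → z'.idx ≤ v.idx →
      z'.idx < w'.idx}

open Classical in
/-- Global traces. As a local trace only contains the causal past of its end, the node at which a
thread is created need not have its outgoing `create` edge inside the trace: it is required that the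
control-flow graph offers that edge, and that the edge taken inside the trace, if any, is a
matching `create` edge. -/
structure IsGlobalTrace : Prop where
  /-- the graph is the union of raw traces of threads with distinct ids -/
  raw : ∃ (I : Set Val) (ρ : Val → RawTrace N X G M Ex Val), I ⊆ P.ids ∧
    (∀ i ∈ I, P.IsRaw i (ρ i)) ∧
    t.nodes = {v | ∃ i ∈ I, v ∈ (ρ i).nodes} ∧ t.acts = {e | ∃ i ∈ I, e ∈ (ρ i).acts}
  /-- the causality order is a partial order (the generating relation has no cycles) -/
  acyclic : ∀ v, ¬ Relation.TransGen t.Imm v v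
  /-- with least element `(0, u₀, σ₀)` -/
  root : ∃ r ∈ t.nodes, P.IsRoot r ∧ ∀ v ∈ t.nodes, t.Le r v
  cr_dom : ∀ z s, t.cr z s → z ∈ t.nodes ∧ s ∈ t.nodes ∧ s.idx = 0 ∧ ¬ P.IsRoot s ∧
    (∃ x v, (z.pt, Action.create x s.pt, v) ∈ P.edges) ∧
    s.st = Function.update z.st P.self (P.tid s) ∧
    ∀ A z', (z, A, z') ∈ t.acts → ∃ x, A = .create x s.pt ∧ z'.st x = P.tid s
  cr_pred : ∀ s ∈ t.nodes, s.idx = 0 → ¬ P.IsRoot s → ∃! z, t.cr z s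
  cr_succ : ∀ z s s', t.cr z s → t.cr z s' → s = s'
  lk_dom : ∀ a z y, t.lk a z y → z ∈ t.nodes ∧
    (P.IsRoot z ∨ ∃ w, (w, Action.unlock a, z) ∈ t.acts) ∧ ∃ w, (w, Action.lock a, y) ∈ t.acts
  lk_succ : ∀ a z y y', t.lk a z y → t.lk a z y' → y = y'
  lk_pred : ∀ a w y, (w, Action.lock a, y) ∈ t.acts → ∃! z, t.lk a z y
  /-- mutexes are not re-entrant -/
  lock_free : ∀ a v v', (v, Action.lock a, v') ∈ t.acts → a ∉ P.lockset t v
  /-- mutexes are only released by a thread that holds them -/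
  unlock_held : ∀ a v v', (v, Action.unlock a, v') ∈ t.acts → a ∈ P.lockset t v
  /-- the value read for a global is the last value written to it -/
  globals : ∀ x g v v', (v, Action.read x g, v') ∈ t.acts →
    ∃ w y w', (w, Action.write g y, w') ∈ t.acts ∧ t.Le w' v ∧
      (∀ z y' z', (z, Action.write g y', z') ∈ t.acts → t.Le z' v → t.Le w' z' → z' = w') ∧
      v'.st x = w.st y

/-- Local traces: global traces whose last node is above all nodes (for finite traces: is the
unique maximal node). -/
structure IsLocalTrace : Prop extends P.IsGlobalTrace t where
  sink_mem : t.sink ∈ t.nodes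
  sink_max : ∀ v ∈ t.nodes, t.Le v t.sink

/-- The initial local trace `0_σ`. -/
def initTrace (σ : X → Val) : Trace N X G M Ex Val where
  nodes := {⟨0, P.start, σ⟩}
  acts := ∅
  cr _ _ := False
  lk _ _ _ := False
  sink := ⟨0, P.start, σ⟩

def init : Set (Trace N X G M Ex Val) := {t | ∃ σ, σ P.self = P.tid0 ∧ t = P.initTrace σ}

open Classical in
/-- `new u₁ t`: the trace of a thread created at the end of `t` and starting at `u₁`. -/
def new (u₁ : N) (t : Trace N X G M Ex Val) : Set (Trace N X G M Ex Val) :=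
  {t' | P.IsLocalTrace t' ∧
    t'.sink = ⟨0, u₁, Function.update t.sink.st P.self (P.nu t)⟩ ∧
    t'.nodes = insert t'.sink t.nodes ∧
    t'.acts = t.acts ∧
    (∀ v w, t'.cr v w ↔ t.cr v w ∨ (v = t.sink ∧ w = t'.sink)) ∧
    t'.lk = t.lk}

open Classical in
/-- `⟦(u, A, u')⟧ t₀` for actions `A` other than `lock`. -/
def sem (u : N) (A : Action N X G M Ex) (u' : N) (t₀ : Trace N X G M Ex Val) :
    Set (Trace N X G M Ex Val) :=
  {t' | P.IsLocalTrace t' ∧ t₀.sink.pt = u ∧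
    t'.sink.idx = t₀.sink.idx + 1 ∧ t'.sink.pt = u' ∧
    P.Step A t₀.sink.st t'.sink.st ∧
    (∀ x u₁, A = .create x u₁ → t'.sink.st = Function.update t₀.sink.st x (P.nu t₀)) ∧
    t'.nodes = insert t'.sink t₀.nodes ∧
    t'.acts = insert (t₀.sink, A, t'.sink) t₀.acts ∧
    t'.cr = t₀.cr ∧ t'.lk = t₀.lk}

/-- `⟦(u, lock(a), u')⟧ (t₀, t₁)`: the merge of `t₀` with the trace `t₁` which is initial or ends in
`unlock(a)`, extended by the acquisition of `a`. -/
def semLock (u : N) (a : M) (u' : N) (t₀ t₁ : Trace N X G M Ex Val) :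
    Set (Trace N X G M Ex Val) :=
  {t' | P.IsLocalTrace t' ∧ (t₁ ∈ P.init ∨ t₁.LastIs (.unlock a)) ∧ t₀.sink.pt = u ∧
    t'.sink = ⟨t₀.sink.idx + 1, u', t₀.sink.st⟩ ∧
    t'.nodes = insert t'.sink (t₀.nodes ∪ t₁.nodes) ∧
    t'.acts = insert (t₀.sink, .lock a, t'.sink) (t₀.acts ∪ t₁.acts) ∧
    (∀ v w, t'.cr v w ↔ t₀.cr v w ∨ t₁.cr v w) ∧
    (∀ b v w, t'.lk b v w ↔
      t₀.lk b v w ∨ t₁.lk b v w ∨ (b = a ∧ v = t₁.sink ∧ w = t'.sink))}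

/-- The set `𝒯` of all local traces of the program: the least set containing the initial traces and
closed under `new` and the operations of the control-flow edges. -/
inductive Traces (P : Program N X G M Ex Val) : Trace N X G M Ex Val → Prop
  | init (t₀ : Trace N X G M Ex Val) : t₀ ∈ P.init → Traces P t₀
  | new (t₀ t' : Trace N X G M Ex Val) (u₁ : N) : Traces P t₀ → t' ∈ P.new u₁ t₀ → Traces P t'
  | edge (t₀ t' : Trace N X G M Ex Val) (u : N) (A : Action N X G M Ex) (u' : N) :
      (u, A, u') ∈ P.edges → (∀ a, A ≠ .lock a) → Traces P t₀ → t' ∈ P.sem u A u' t₀ → Traces P t'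
  | lock (t₀ t₁ t' : Trace N X G M Ex Val) (u : N) (a : M) (u' : N) :
      (u, Action.lock a, u') ∈ P.edges → Traces P t₀ → Traces P t₁ →
      t' ∈ P.semLock u a u' t₀ t₁ → Traces P t'

/-- Traces at whose end the ego thread holds the lockset `S`; `𝒯_S` is the intersection with `𝒯`. -/
def withLocks (S : Set M) : Set (Trace N X G M Ex Val) := {t | P.lockset t t.sink = S}

end Program

/-! ### The constraint system of the local trace semantics -/

/-- Unknowns `[u]` and `[a]`. -/
inductive Unk (N M : Type u) : Type u
  | pt (u : N)
  | mx (a : M)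

@[reducible]
def TraceDom (N X G M Ex Val : Type u) : Unk N M → Type u := fun _ => Set (Trace N X G M Ex Val)

namespace Program

variable (P : Program N X G M Ex Val)

/-- Right-hand sides `⟦u, A⟧`, for the edge `(u, A, u')`. -/
noncomputable def rhs (u : N) (A : Action N X G M Ex) (u' : N)
    (η : ∀ x, TraceDom N X G M Ex Val x) :
    (∀ x, TraceDom N X G M Ex Val x) × Set (Trace N X G M Ex Val) :=
  match A with
  | .create x u₁ => (effect (.pt u₁) (⋃ t ∈ η (.pt u), P.new u₁ t),
      ⋃ t ∈ η (.pt u), P.sem u (.create x u₁) u' t)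
  | .lock a => (⊥, ⋃ t₀ ∈ η (.pt u), ⋃ t₁ ∈ η (.mx a), P.semLock u a u' t₀ t₁)
  | .unlock a => (effect (.mx a) (⋃ t ∈ η (.pt u), P.sem u (.unlock a) u' t),
      ⋃ t ∈ η (.pt u), P.sem u (.unlock a) u' t)
  | .guard r => (⊥, ⋃ t ∈ η (.pt u), P.sem u (.guard r) u' t)
  | .assign x r => (⊥, ⋃ t ∈ η (.pt u), P.sem u (.assign x r) u' t)
  | .read x g => (⊥, ⋃ t ∈ η (.pt u), P.sem u (.read x g) u' t)
  | .write g x => (⊥, ⋃ t ∈ η (.pt u), P.sem u (.write g x) u' t)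

/-- The constraint system `𝒞`; the unknowns `[a]` are initialized to `init`. -/
def traceSystem : Set (SEConstraint (TraceDom N X G M Ex Val)) :=
  {⟨.pt P.start, fun _ => (⊥, P.init)⟩} ∪
  {c | ∃ a : M, c = ⟨.mx a, fun _ => (⊥, P.init)⟩} ∪
  {c | ∃ u A u', (u, A, u') ∈ P.edges ∧ c = ⟨.pt u', P.rhs u A u'⟩}

/-! ### Last thread-local operations -/

variable (t : Trace N X G M Ex Val)

/-- `last_tl_write_g t = (w, g = y, w')`. -/
def IsLastTlWrite (g : G) (w : Node N X Val) (y : X) (w' : Node N X Val) : Prop :=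
  (w, Action.write g y, w') ∈ t.acts ∧ P.tid w' = P.tid t.sink ∧
  ∀ z y' z', (z, Action.write g y', z') ∈ t.acts → P.tid z' = P.tid t.sink → z'.idx ≤ w'.idx

/-- `last_tl_lock_a t = (w, lock(a), w')`. -/
def IsLastTlLock (a : M) (w w' : Node N X Val) : Prop :=
  (w, Action.lock a, w') ∈ t.acts ∧ P.tid w' = P.tid t.sink ∧
  ∀ z z', (z, Action.lock a, z') ∈ t.acts → P.tid z' = P.tid t.sink → z'.idx ≤ w'.idx

end Program

/-! ### Lock-Centered Reading -/

/-- Upward-closed sets of locksets, ordered by inclusion (Mathlib orders `UpperSet` by reverse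
inclusion, hence the order dual). -/
abbrev ULocks (M : Type u) : Type u := (UpperSet (Set M))ᵒᵈ

/-- Triples `(V, L, σ)`. The sets `V a` of definitely written globals are ordered by superset. -/
abbrev State (X G M D : Type u) : Type u :=
  (M → (Set G)ᵒᵈ) × (M → ULocks M) × (X ⊕ G → D)

/-- The element of `ULocks M` represented by the set `{S}` of minimal locksets. -/
def single (S : Set M) : ULocks M := OrderDual.toDual (UpperSet.Ici S)

/-- The abstraction `β t = (V, L, σ)` of a local trace. -/
noncomputable def Program.beta (P : Program N X G M Ex Val) (t : Trace N X G M Ex Val) :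
    State X G M (Set Val) :=
  (fun a => OrderDual.toDual {g | ∃ w y w', P.IsLastTlWrite t g w y w' ∧
      ∀ v v', P.IsLastTlLock t a v v' → t.Le v' w'},
   fun a => OrderDual.toDual
      (upperClosure {B | ∃ v v', P.IsLastTlLock t a v v' ∧ B = P.lockset t v}),
   Sum.elim (fun x => {t.sink.st x})
      (fun g => {d | ∃ w y w', P.IsLastTlWrite t g w y w' ∧ d = w.st y}))

/-- The parameters of the analysis: concretization of abstract values, abstract evaluation of
expressions over locals, abstract guards, and abstract ids `ν♯ u (V, L, σ) u₁` of created threads. -/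
structure Analysis (N X G M Ex Val D : Type u) : Type u where
  conc : D → Set Val
  evalA : Ex → (X → D) → D
  guardA : Ex → (X ⊕ G → D) → (X ⊕ G → D)
  nuA : N → State X G M D → N → D

end

section

variable {N X G M Ex Val D : Type u} [CompleteLattice D]

/-- The concretization `γ_{u,S}`. -/
def gammaPt (P : Program N X G M Ex Val) (𝒜 : Analysis N X G M Ex Val D) (u : N) (S : Set M)
    (s : State X G M D) : Set (Trace N X G M Ex Val) :=
  {t | P.Traces t ∧ t ∈ P.withLocks S ∧ t.sink.pt = u ∧ (P.beta t).1 ≤ s.1 ∧ (P.beta t).2.1 ≤ s.2.1 ∧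
    ∀ z, (P.beta t).2.2 z ⊆ 𝒜.conc (s.2.2 z)}

/-- The concretization `γ_{g,a,S}`. -/
def gammaGl (P : Program N X G M Ex Val) (𝒜 : Analysis N X G M Ex Val D) (g : G) (a : M)
    (S : Set M) (d : D) : Set (Trace N X G M Ex Val) :=
  {t | P.Traces t ∧ t ∈ P.withLocks S ∧ t.LastIs (.unlock a) ∧
      ∃ w y w', P.IsLastTlWrite t g w y w' ∧ w.st y ∈ 𝒜.conc d} ∪
  {t | P.Traces t ∧ t ∈ P.withLocks S ∧ t.LastIs (.unlock a) ∧ ¬ ∃ w y w', P.IsLastTlWrite t g w y w'}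

/-- The basic abstract operations are sound abstractions of their concrete counterparts. -/
structure Analysis.Sound (P : Program N X G M Ex Val) (𝒜 : Analysis N X G M Ex Val D) : Prop where
  conc_mono : Monotone 𝒜.conc
  conc_top : 𝒜.conc ⊤ = Set.univ
  eval : ∀ r (σ : X → Val) (s : X → D), (∀ x, σ x ∈ 𝒜.conc (s x)) →
    P.eval r σ ∈ 𝒜.conc (𝒜.evalA r s)
  guard : ∀ r (σ : X → Val) (ω : G → Set Val) (s : X ⊕ G → D),
    (∀ x, σ x ∈ 𝒜.conc (s (.inl x))) → (∀ g, ω g ⊆ 𝒜.conc (s (.inr g))) →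
    P.eval r σ ≠ P.zero →
    (∀ x, σ x ∈ 𝒜.conc (𝒜.guardA r s (.inl x))) ∧ ∀ g, ω g ⊆ 𝒜.conc (𝒜.guardA r s (.inr g))
  nu : ∀ u x u₁ v S s t, (u, Action.create x u₁, v) ∈ P.edges → t ∈ gammaPt P 𝒜 u S s →
    P.nu t ∈ 𝒜.conc (𝒜.nuA u s u₁)

/-- Unknowns `[u, S]` and `[g, a, S]`. -/
inductive AUnk (N G M : Type u) : Type u
  | pt (u : N) (S : Set M)
  | gl (g : G) (a : M) (S : Set M)

@[reducible]
def ADom (N X G M D : Type u) : AUnk N G M → Type u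
  | .pt _ _ => State X G M D
  | .gl _ _ _ => D

noncomputable instance instCompleteLatticeADom (x : AUnk N G M) :
    CompleteLattice (ADom N X G M D x) :=
  match x with
  | .pt _ _ => inferInstanceAs (CompleteLattice (State X G M D))
  | .gl _ _ _ => inferInstanceAs (CompleteLattice D)

/-- The lockset after an action executed with lockset `S`. -/
def postLocks (A : Action N X G M Ex) (S : Set M) : Set M :=
  match A with
  | .lock a => S ∪ {a}
  | .unlock a => S \ {a}
  | _ => S

/-- The start state `init♯`; it is also used, up to `σ`, for created threads. -/
noncomputable def initState : State X G M D :=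
  (fun _ => OrderDual.toDual ∅, fun _ => OrderDual.toDual (upperClosure ∅),
    Sum.elim (fun _ => ⊤) (fun _ => ⊥))

open Classical in
/-- Right-hand sides `⟦[u,S], A⟧♯` of Lock-Centered Reading. -/
noncomputable def arhs (P : Program N X G M Ex Val) (𝒜 : Analysis N X G M Ex Val D) (u : N)
    (S : Set M) (A : Action N X G M Ex) (η : ∀ x, ADom N X G M D x) :
    (∀ x, ADom N X G M D x) × State X G M D :=
  let V : M → (Set G)ᵒᵈ := (η (.pt u S)).1
  let L : M → ULocks M := (η (.pt u S)).2.1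
  let σ : X ⊕ G → D := (η (.pt u S)).2.2
  match A with
  | .guard r => (⊥, (V, L, 𝒜.guardA r σ))
  | .assign x r => (⊥, (V, L, Function.update σ (.inl x) (𝒜.evalA r fun y => σ (.inl y))))
  | .create x u₁ =>
      let i := 𝒜.nuA u (V, L, σ) u₁
      let σ' : X ⊕ G → D :=
        Sum.elim (Function.update (fun y => σ (.inl y)) P.self i) (fun _ => ⊥)
      (effect (.pt u₁ ∅)
        ((fun _ => OrderDual.toDual ∅, fun _ => OrderDual.toDual (upperClosure ∅), σ') :
          State X G M D),
        (V, L, Function.update σ (.inl x) i))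
  | .lock a => (⊥, (Function.update V a (OrderDual.toDual ∅), Function.update L a (single S), σ))
  | .unlock a =>
      (fun y => match y with
        | .pt _ _ => ⊥
        | .gl g b S' => if b = a ∧ S' = S \ {a} then σ (.inr g) else ⊥,
        (V, L, σ))
  | .write g x =>
      (⊥, (fun a => OrderDual.toDual (OrderDual.ofDual (V a) ∪ {g}), L,
        Function.update σ (.inr g) (σ (.inl x))))
  | .read x g =>
      let d : D := sSup {d | ∃ a S' B, g ∉ OrderDual.ofDual (V a) ∧ B ∈ OrderDual.ofDual (L a) ∧
        B ∩ S' = ∅ ∧ d = η (.gl g a S')}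
      (⊥, (V, L, Function.update σ (.inl x) (σ (.inr g) ⊔ d)))

/-- The constraint system `𝒞₂` of Lock-Centered Reading. -/
def lockCentered (P : Program N X G M Ex Val) (𝒜 : Analysis N X G M Ex Val D) :
    Set (SEConstraint (ADom N X G M D)) :=
  {⟨.pt P.start ∅, fun _ => (⊥, initState)⟩} ∪
  {c | ∃ u A u' S, (u, A, u') ∈ P.edges ∧ c = ⟨.pt u' (postLocks A S), arhs P 𝒜 u S A⟩}

end

end LockCentered

open LockCentered

/-!
The least solution of the concrete system sorts `𝒯` by program points and last actions: `η [u]`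
consists of the traces of `𝒯` that end at `u`, and `η [a]` of the initial traces and the traces that
end with `unlock(a)`. Moreover `𝒯` contains the causal past of every node of its traces, so that
properties of traces can be proved by induction over proper causal pasts.

Mutual exclusion is the heart of the analysis. Each mutex `a` is passed on from one critical section
to the next along `→_a`, every section has at most one successor, and all of them are reached from
the section that follows the root; hence they are linearly ordered by causality. As `g` is only
accessed while `m_g` is held, its writes are linearly ordered too. Suppose the value read by the ego
thread was written by another thread. That thread released `m_g` before the ego thread last acquired
it. Consider the latest moment at which the writer, after its write, released some mutex `a` that
the ego thread acquired for the last time thereafter. A mutex held both by the writer at that moment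
and by the ego thread before acquiring `a` would yield either a later such moment or a causal cycle,
so the two locksets are disjoint; and the ego thread has not written `g` since, as the write read is
the last one. The corresponding causal past of the writer's thread is a trace in `η [a]`, and
soundness of the abstract read follows by induction.
-/

namespace LockCentered

variable {N X G M Ex Val : Type u} {P : Program N X G M Ex Val} {t : Trace N X G M Ex Val}

/-! ### Causality and program order in global traces -/

lemma Trace.le_of_act {v w : Node N X Val} {A : Action N X G M Ex} (e : (v, A, w) ∈ t.acts) :
    t.Le v w :=
  .single (.inl ⟨A, e⟩)

lemma Trace.le_of_lk {a : M} {v w : Node N X Val} (e : t.lk a v w) : t.Le v w :=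
  .single (.inr (.inr ⟨a, e⟩))

namespace Program.IsGlobalTrace

lemma exists_isRaw_of_act (h : P.IsGlobalTrace t) {v w : Node N X Val} {A : Action N X G M Ex}
    (e : (v, A, w) ∈ t.acts) :
    ∃ i ρ j, P.IsRaw i ρ ∧ ρ.nodes ⊆ t.nodes ∧ j < ρ.len ∧
      v = ρ.node j ∧ A = ρ.act j ∧ w = ρ.node (j + 1) := by
  obtain ⟨I, ρ, -, hρ, hnodes, hacts⟩ := h.raw
  rw [hacts] at e
  obtain ⟨i, hi, j, hj, e⟩ := e
  simp only [Prod.mk.injEq] at e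
  exact ⟨i, ρ i, j, hρ i hi, fun v hv => hnodes ▸ ⟨i, hi, hv⟩, hj, e⟩

lemma source_mem (h : P.IsGlobalTrace t) {v w : Node N X Val} {A : Action N X G M Ex}
    (e : (v, A, w) ∈ t.acts) : v ∈ t.nodes := by
  obtain ⟨i, ρ, j, -, hn, hj, rfl, -, -⟩ := h.exists_isRaw_of_act e
  exact hn ⟨j, hj.le, rfl⟩

lemma target_mem (h : P.IsGlobalTrace t) {v w : Node N X Val} {A : Action N X G M Ex}
    (e : (v, A, w) ∈ t.acts) : w ∈ t.nodes := by
  obtain ⟨i, ρ, j, -, hn, hj, -, -, rfl⟩ := h.exists_isRaw_of_act e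
  exact hn ⟨j + 1, hj, rfl⟩

lemma tid_eq (h : P.IsGlobalTrace t) {v w : Node N X Val} {A : Action N X G M Ex}
    (e : (v, A, w) ∈ t.acts) : P.tid v = P.tid w := by
  obtain ⟨i, ρ, j, hρ, -, hj, rfl, -, rfl⟩ := h.exists_isRaw_of_act e
  exact (hρ.1 j hj.le).trans (hρ.1 (j + 1) hj).symm

lemma idx_eq (h : P.IsGlobalTrace t) {v w : Node N X Val} {A : Action N X G M Ex}
    (e : (v, A, w) ∈ t.acts) : w.idx = v.idx + 1 := by
  obtain ⟨i, ρ, j, -, -, -, rfl, -, rfl⟩ := h.exists_isRaw_of_act e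
  rfl

lemma edge_mem (h : P.IsGlobalTrace t) {v w : Node N X Val} {A : Action N X G M Ex}
    (e : (v, A, w) ∈ t.acts) : (v.pt, A, w.pt) ∈ P.edges := by
  obtain ⟨i, ρ, j, hρ, -, hj, rfl, rfl, rfl⟩ := h.exists_isRaw_of_act e
  exact (hρ.2 j hj).1

lemma step (h : P.IsGlobalTrace t) {v w : Node N X Val} {A : Action N X G M Ex}
    (e : (v, A, w) ∈ t.acts) : P.Step A v.st w.st := by
  obtain ⟨i, ρ, j, hρ, -, hj, rfl, rfl, rfl⟩ := h.exists_isRaw_of_act e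
  exact (hρ.2 j hj).2

lemma eq_of_tid_eq_of_idx_eq (h : P.IsGlobalTrace t) {v w : Node N X Val} (hv : v ∈ t.nodes)
    (hw : w ∈ t.nodes) (hid : P.tid v = P.tid w) (hidx : v.idx = w.idx) : v = w := by
  obtain ⟨I, ρ, -, hρ, hnodes, -⟩ := h.raw
  rw [hnodes] at hv hw
  obtain ⟨i, hi, j, hj, rfl⟩ := hv
  obtain ⟨i', hi', j', hj', rfl⟩ := hw
  obtain rfl : i = i' := ((hρ i hi).1 j hj).symm.trans (hid.trans ((hρ i' hi').1 j' hj'))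
  obtain rfl : j = j' := hidx
  rfl

lemma act_unique (h : P.IsGlobalTrace t) {v w w' : Node N X Val} {A A' : Action N X G M Ex}
    (e : (v, A, w) ∈ t.acts) (e' : (v, A', w') ∈ t.acts) : A = A' := by
  obtain ⟨I, ρ, -, hρ, -, hacts⟩ := h.raw
  rw [hacts] at e e'
  obtain ⟨i, hi, j, hj, e⟩ := e
  obtain ⟨i', hi', j', hj', e'⟩ := e'
  simp only [Prod.mk.injEq] at e e'
  obtain ⟨rfl, rfl, -⟩ := e
  obtain ⟨hv, rfl, -⟩ := e'
  obtain rfl : i = i' := ((hρ i hi).1 j hj.le).symm.trans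
    ((congrArg P.tid hv).trans ((hρ i' hi').1 j' hj'.le))
  obtain rfl : j = j' := congrArg Node.idx hv
  rfl

lemma eq_of_act_of_act_target (h : P.IsGlobalTrace t) {v v' w : Node N X Val}
    {A A' : Action N X G M Ex} (e : (v, A, w) ∈ t.acts) (e' : (v', A', w) ∈ t.acts) :
    v = v' ∧ A = A' := by
  obtain rfl : v = v' := h.eq_of_tid_eq_of_idx_eq (h.source_mem e) (h.source_mem e')
    ((h.tid_eq e).trans (h.tid_eq e').symm)
    (Nat.succ.inj ((h.idx_eq e).symm.trans (h.idx_eq e')))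
  exact ⟨rfl, h.act_unique e e'⟩

lemma exists_act_of_idx_ne_zero (h : P.IsGlobalTrace t) {w : Node N X Val} (hw : w ∈ t.nodes)
    (hpos : w.idx ≠ 0) : ∃ v A, (v, A, w) ∈ t.acts := by
  obtain ⟨I, ρ, -, -, hnodes, hacts⟩ := h.raw
  rw [hnodes] at hw
  obtain ⟨i, hi, j, hj, rfl⟩ := hw
  obtain ⟨k, rfl⟩ : ∃ k, j = k + 1 := Nat.exists_eq_succ_of_ne_zero hpos
  exact ⟨(ρ i).node k, (ρ i).act k, hacts ▸ ⟨i, hi, k, hj, rfl⟩⟩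

lemma mem_of_imm (h : P.IsGlobalTrace t) {v w : Node N X Val} (hvw : t.Imm v w) :
    v ∈ t.nodes ∧ w ∈ t.nodes := by
  rcases hvw with ⟨A, e⟩ | hcr | ⟨a, hlk⟩
  · exact ⟨h.source_mem e, h.target_mem e⟩
  · exact ⟨(h.cr_dom _ _ hcr).1, (h.cr_dom _ _ hcr).2.1⟩
  · obtain ⟨hv, -, w', e⟩ := h.lk_dom _ _ _ hlk
    exact ⟨hv, h.target_mem e⟩

lemma mem_of_le (h : P.IsGlobalTrace t) {v w : Node N X Val} (hvw : t.Le v w)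
    (hw : w ∈ t.nodes) : v ∈ t.nodes := by
  rcases hvw.cases_head with rfl | ⟨c, hvc, -⟩
  · exact hw
  · exact (h.mem_of_imm hvc).1

lemma le_antisymm (h : P.IsGlobalTrace t) {v w : Node N X Val} (hvw : t.Le v w)
    (hwv : t.Le w v) : v = w := by
  rcases Relation.reflTransGen_iff_eq_or_transGen.1 hvw with rfl | hlt
  · rfl
  · exact absurd (hlt.trans_left hwv) (h.acyclic v)

lemma ne_of_imm (h : P.IsGlobalTrace t) {v w : Node N X Val} (hvw : t.Imm v w) : v ≠ w := by
  rintro rfl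
  exact h.acyclic v (.single hvw)

lemma exists_le_of_le_idx (h : P.IsGlobalTrace t) {w : Node N X Val} (hw : w ∈ t.nodes) {k : ℕ}
    (hk : k ≤ w.idx) : ∃ v ∈ t.nodes, P.tid v = P.tid w ∧ v.idx = k ∧ t.Le v w := by
  obtain ⟨d, hd⟩ := Nat.exists_eq_add_of_le hk
  induction d generalizing w with
  | zero => exact ⟨w, hw, rfl, hd, .refl⟩
  | succ d ih =>
    obtain ⟨v, A, e⟩ := h.exists_act_of_idx_ne_zero hw (by omega)
    have hidx := h.idx_eq e
    obtain ⟨z, hz, hid, hzk, hzv⟩ := ih (h.source_mem e) (by omega) (by omega)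
    exact ⟨z, hz, hid.trans (h.tid_eq e), hzk, hzv.trans (Trace.le_of_act e)⟩

lemma le_of_idx_le (h : P.IsGlobalTrace t) {v w : Node N X Val} (hv : v ∈ t.nodes)
    (hw : w ∈ t.nodes) (hid : P.tid v = P.tid w) (hidx : v.idx ≤ w.idx) : t.Le v w := by
  obtain ⟨z, hz, hzid, hzidx, hzw⟩ := h.exists_le_of_le_idx hw hidx
  rwa [h.eq_of_tid_eq_of_idx_eq hv hz (hid.trans hzid.symm) hzidx.symm]

lemma idx_le_of_le (h : P.IsGlobalTrace t) {v w : Node N X Val} (hw : w ∈ t.nodes)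
    (hid : P.tid v = P.tid w) (hvw : t.Le v w) : v.idx ≤ w.idx := by
  rcases le_total v.idx w.idx with hle | hle
  · exact hle
  · exact (h.le_antisymm hvw (h.le_of_idx_le hw (h.mem_of_le hvw hw) hid.symm hle) ▸ le_rfl)

end Program.IsGlobalTrace

lemma Program.IsLocalTrace.idx_le_sink (h : P.IsLocalTrace t) {v : Node N X Val}
    (hv : v ∈ t.nodes) (hid : P.tid v = P.tid t.sink) : v.idx ≤ t.sink.idx :=
  h.idx_le_of_le h.sink_mem hid (h.sink_max v hv)

/-! ### Subtraces and causal pasts -/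

/-- Containment of the graphs and orders of traces, irrespective of their sinks. -/
structure Trace.Sub (s t : Trace N X G M Ex Val) : Prop where
  nodes : s.nodes ⊆ t.nodes
  acts : s.acts ⊆ t.acts
  cr : ∀ v w, s.cr v w → t.cr v w
  lk : ∀ a v w, s.lk a v w → t.lk a v w

namespace Trace.Sub

variable {s : Trace N X G M Ex Val}

lemma le (h : s.Sub t) {v w : Node N X Val} (hvw : s.Le v w) : t.Le v w := by
  refine Relation.ReflTransGen.mono ?_ _ _ hvw
  rintro v w (⟨A, e⟩ | hcr | ⟨a, hlk⟩)
  · exact .inl ⟨A, h.acts e⟩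
  · exact .inr (.inl (h.cr _ _ hcr))
  · exact .inr (.inr ⟨a, h.lk _ _ _ hlk⟩)

lemma act_mem (h : s.Sub t) (hs : P.IsGlobalTrace s) (ht : P.IsGlobalTrace t)
    {v w : Node N X Val} {A : Action N X G M Ex} (e : (v, A, w) ∈ t.acts) (hw : w ∈ s.nodes) :
    (v, A, w) ∈ s.acts := by
  obtain ⟨v', A', e'⟩ := hs.exists_act_of_idx_ne_zero hw (by rw [ht.idx_eq e]; omega)
  obtain ⟨rfl, rfl⟩ := ht.eq_of_act_of_act_target e (h.acts e')
  exact e'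

lemma cr_of_mem (h : s.Sub t) (hs : P.IsGlobalTrace s) (ht : P.IsGlobalTrace t)
    {v w : Node N X Val} (hvw : t.cr v w) (hw : w ∈ s.nodes) : s.cr v w := by
  obtain ⟨-, hwt, hidx, hroot, -⟩ := ht.cr_dom _ _ hvw
  obtain ⟨z, hz, -⟩ := hs.cr_pred w hw hidx hroot
  rwa [(ht.cr_pred w hwt hidx hroot).unique hvw (h.cr _ _ hz)]

lemma lk_of_mem (h : s.Sub t) (hs : P.IsGlobalTrace s) (ht : P.IsGlobalTrace t) {a : M}
    {v w : Node N X Val} (hvw : t.lk a v w) (hw : w ∈ s.nodes) : s.lk a v w := by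
  obtain ⟨-, -, z, e⟩ := ht.lk_dom _ _ _ hvw
  obtain ⟨z', hz', -⟩ := hs.lk_pred a z w (h.act_mem hs ht e hw)
  rwa [(ht.lk_pred a z w e).unique hvw (h.lk _ _ _ hz')]

lemma imm_of_mem (h : s.Sub t) (hs : P.IsGlobalTrace s) (ht : P.IsGlobalTrace t)
    {v w : Node N X Val} (hvw : t.Imm v w) (hw : w ∈ s.nodes) : s.Imm v w := by
  rcases hvw with ⟨A, e⟩ | hcr | ⟨a, hlk⟩
  · exact .inl ⟨A, h.act_mem hs ht e hw⟩
  · exact .inr (.inl (h.cr_of_mem hs ht hcr hw))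
  · exact .inr (.inr ⟨a, h.lk_of_mem hs ht hlk hw⟩)

lemma le_iff (h : s.Sub t) (hs : P.IsGlobalTrace s) (ht : P.IsGlobalTrace t)
    {v w : Node N X Val} (hw : w ∈ s.nodes) : t.Le v w ↔ s.Le v w := by
  refine ⟨fun hvw => ?_, h.le⟩
  induction hvw using Relation.ReflTransGen.head_induction_on with
  | refl => exact .refl
  | head hvc _ ih => exact .head (h.imm_of_mem hs ht hvc (hs.mem_of_le ih hw)) ih

lemma act_mem_iff_of_idx_le (h : s.Sub t) (hs : P.IsGlobalTrace s) (ht : P.IsGlobalTrace t)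
    {v z z' : Node N X Val} {A : Action N X G M Ex} (hv : v ∈ s.nodes) (hid : P.tid z' = P.tid v)
    (hidx : z'.idx ≤ v.idx) : (z, A, z') ∈ t.acts ↔ (z, A, z') ∈ s.acts := by
  refine ⟨fun e => h.act_mem hs ht e (hs.mem_of_le ?_ hv), fun e => h.acts e⟩
  exact (h.le_iff hs ht hv).1 (ht.le_of_idx_le (ht.target_mem e) (h.nodes hv) hid hidx)

lemma lockset_eq (h : s.Sub t) (hs : P.IsGlobalTrace s) (ht : P.IsGlobalTrace t)
    {v : Node N X Val} (hv : v ∈ s.nodes) : P.lockset t v = P.lockset s v := by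
  ext a
  constructor
  · rintro ⟨w, w', e, hid, hidx, hmin⟩
    exact ⟨w, w', (h.act_mem_iff_of_idx_le hs ht hv hid hidx).1 e, hid, hidx,
      fun z z' e' => hmin z z' (h.acts e')⟩
  · rintro ⟨w, w', e, hid, hidx, hmin⟩
    exact ⟨w, w', h.acts e, hid, hidx, fun z z' e' hid' hidx' =>
      hmin z z' ((h.act_mem_iff_of_idx_le hs ht hv hid' hidx').1 e') hid' hidx'⟩

end Trace.Sub

/-- The causal past of the node `v` in `t`, as a trace with sink `v`. -/
def Trace.past (t : Trace N X G M Ex Val) (v : Node N X Val) : Trace N X G M Ex Val where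
  nodes := {w | w ∈ t.nodes ∧ t.Le w v}
  acts := {e | e ∈ t.acts ∧ t.Le e.2.2 v}
  cr w w' := t.cr w w' ∧ t.Le w' v
  lk a w w' := t.lk a w w' ∧ t.Le w' v
  sink := v

lemma Trace.past_sub (t : Trace N X G M Ex Val) (v : Node N X Val) : (t.past v).Sub t :=
  ⟨fun _ h => h.1, fun _ h => h.1, fun _ _ h => h.1, fun _ _ _ h => h.1⟩

lemma Program.IsLocalTrace.past_sink (h : P.IsLocalTrace t) : t.past t.sink = t := by
  ext v w x
  · exact and_iff_left_of_imp (h.sink_max v)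
  · exact and_iff_left_of_imp fun e => h.sink_max _ (h.target_mem e)
  · exact and_iff_left_of_imp fun hcr => h.sink_max _ (h.cr_dom _ _ hcr).2.1
  · exact and_iff_left_of_imp fun hlk => h.sink_max _ (h.mem_of_imm (.inr (.inr ⟨_, hlk⟩))).2
  all_goals rfl

lemma Trace.Sub.past_eq {s : Trace N X G M Ex Val} (h : s.Sub t) (hs : P.IsGlobalTrace s)
    (ht : P.IsGlobalTrace t) {v : Node N X Val} (hv : v ∈ s.nodes) : t.past v = s.past v := by
  have le_iff {w} : t.Le w v ↔ s.Le w v := h.le_iff hs ht hv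
  have mem {w} (hw : s.Le w v) : w ∈ s.nodes := hs.mem_of_le hw hv
  ext1
  · ext w
    exact ⟨fun ⟨_, h2⟩ => ⟨mem (le_iff.1 h2), le_iff.1 h2⟩,
      fun ⟨h1, h2⟩ => ⟨h.nodes h1, le_iff.2 h2⟩⟩
  · ext ⟨z, A, w⟩
    exact ⟨fun ⟨h1, h2⟩ => ⟨h.act_mem hs ht h1 (mem (le_iff.1 h2)), le_iff.1 h2⟩,
      fun ⟨h1, h2⟩ => ⟨h.acts h1, le_iff.2 h2⟩⟩
  · ext z w
    exact ⟨fun ⟨h1, h2⟩ => ⟨h.cr_of_mem hs ht h1 (mem (le_iff.1 h2)), le_iff.1 h2⟩,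
      fun ⟨h1, h2⟩ => ⟨h.cr _ _ h1, le_iff.2 h2⟩⟩
  · ext a z w
    exact ⟨fun ⟨h1, h2⟩ => ⟨h.lk_of_mem hs ht h1 (mem (le_iff.1 h2)), le_iff.1 h2⟩,
      fun ⟨h1, h2⟩ => ⟨h.lk _ _ _ h1, le_iff.2 h2⟩⟩
  · rfl

lemma Trace.Sub.past_sink {s : Trace N X G M Ex Val} (h : s.Sub t) (hs : P.IsLocalTrace s)
    (ht : P.IsGlobalTrace t) : t.past s.sink = s :=
  (h.past_eq hs.toIsGlobalTrace ht hs.sink_mem).trans hs.past_sink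

/-! ### The traces of a program -/

namespace Program

variable {t₀ t₁ : Trace N X G M Ex Val} {A : Action N X G M Ex} {u u' u₁ : N} {a : M}

lemma isLocalTrace_initTrace {σ : X → Val} (hσ : σ P.self = P.tid0) :
    P.IsLocalTrace (P.initTrace σ) where
  raw := by
    refine ⟨{P.tid0}, fun _ => ⟨0, fun _ => P.start, fun _ => σ, fun _ => .create P.self P.start⟩,
      Set.singleton_subset_iff.2 P.tid0_mem, ?_, ?_, ?_⟩
    · rintro _ rfl
      exact ⟨fun _ _ => hσ, fun j hj => absurd hj j.not_lt_zero⟩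
    · ext v
      simp [RawTrace.nodes, RawTrace.node, initTrace]
    · ext e
      simp [RawTrace.acts, initTrace]
  acyclic v hv := by
    obtain ⟨w, ⟨_, e⟩ | hcr | ⟨_, hlk⟩, -⟩ := Relation.TransGen.head'_iff.1 hv
    exacts [e, hcr, hlk]
  root := by
    refine ⟨_, rfl, ⟨rfl, rfl, hσ⟩, ?_⟩
    rintro _ rfl
    exact .refl
  cr_dom _ _ h := h.elim
  cr_pred := by
    rintro _ rfl - h
    exact absurd ⟨rfl, rfl, hσ⟩ h
  cr_succ _ _ _ h := h.elim
  lk_dom _ _ _ h := h.elim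
  lk_succ _ _ _ _ h := h.elim
  lk_pred _ _ _ h := h.elim
  lock_free _ _ _ h := h.elim
  unlock_held _ _ _ h := h.elim
  globals _ _ _ _ h := h.elim
  sink_mem := rfl
  sink_max := by
    rintro _ rfl
    exact .refl

lemma sub_of_mem_new (h : t ∈ P.new u₁ t₀) : t₀.Sub t := by
  obtain ⟨-, -, hn, ha, hc, hl⟩ := h
  exact ⟨hn ▸ Set.subset_insert _ _, ha.ge, fun v w e => (hc v w).2 (.inl e),
    fun a v w e => hl ▸ e⟩

lemma sub_of_mem_sem (h : t ∈ P.sem u A u' t₀) : t₀.Sub t := by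
  obtain ⟨-, -, -, -, -, -, hn, ha, hc, hl⟩ := h
  exact ⟨hn ▸ Set.subset_insert _ _, ha ▸ Set.subset_insert _ _, fun v w e => hc ▸ e,
    fun a v w e => hl ▸ e⟩

lemma sub_left_of_mem_semLock (h : t ∈ P.semLock u a u' t₀ t₁) : t₀.Sub t := by
  obtain ⟨-, -, -, -, hn, ha, hc, hl⟩ := h
  exact ⟨hn ▸ Set.subset_union_left.trans (Set.subset_insert _ _),
    ha ▸ Set.subset_union_left.trans (Set.subset_insert _ _),
    fun v w e => (hc v w).2 (.inl e), fun b v w e => (hl b v w).2 (.inl e)⟩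

lemma sub_right_of_mem_semLock (h : t ∈ P.semLock u a u' t₀ t₁) : t₁.Sub t := by
  obtain ⟨-, -, -, -, hn, ha, hc, hl⟩ := h
  exact ⟨hn ▸ Set.subset_union_right.trans (Set.subset_insert _ _),
    ha ▸ Set.subset_union_right.trans (Set.subset_insert _ _),
    fun v w e => (hc v w).2 (.inr e), fun b v w e => (hl b v w).2 (.inr (.inl e))⟩

lemma act_of_mem_sem (h : t ∈ P.sem u A u' t₀) : (t₀.sink, A, t.sink) ∈ t.acts := by
  rw [h.2.2.2.2.2.2.2.1]
  exact Set.mem_insert _ _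

lemma act_of_mem_semLock (h : t ∈ P.semLock u a u' t₀ t₁) :
    (t₀.sink, .lock a, t.sink) ∈ t.acts := by
  rw [h.2.2.2.2.2.1]
  exact Set.mem_insert _ _

lemma imm_of_mem_new (h : t ∈ P.new u₁ t₀) : t.Imm t₀.sink t.sink :=
  .inr (.inl ((h.2.2.2.2.1 _ _).2 (.inr ⟨rfl, rfl⟩)))

namespace Traces

lemma isLocalTrace (ht : P.Traces t) : P.IsLocalTrace t := by
  cases ht with
  | init _ h =>
    obtain ⟨σ, hσ, rfl⟩ := h
    exact isLocalTrace_initTrace hσ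
  | new _ _ _ _ h => exact h.1
  | edge _ _ _ _ _ _ _ _ h => exact h.1
  | lock _ _ _ _ _ _ _ _ _ h => exact h.1

lemma isGlobalTrace (ht : P.Traces t) : P.IsGlobalTrace t :=
  ht.isLocalTrace.toIsGlobalTrace

lemma finite_nodes (ht : P.Traces t) : t.nodes.Finite := by
  induction ht with
  | init _ h =>
    obtain ⟨σ, -, rfl⟩ := h
    exact Set.finite_singleton _
  | new _ _ _ _ h ih =>
    rw [h.2.2.1]
    exact ih.insert _
  | edge _ _ _ _ _ _ _ _ h ih =>
    rw [h.2.2.2.2.2.2.1]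
    exact ih.insert _
  | lock _ _ _ _ _ _ _ _ _ h ih₀ ih₁ =>
    rw [h.2.2.2.2.1]
    exact (ih₀.union ih₁).insert _

lemma past (ht : P.Traces t) {v : Node N X Val} (hv : v ∈ t.nodes) : P.Traces (t.past v) := by
  have past_of_sub {s t : Trace N X G M Ex Val} (hs : P.Traces s) (ht : P.Traces t)
      (hst : s.Sub t) (hv : v ∈ s.nodes) (ih : P.Traces (s.past v)) : P.Traces (t.past v) := by
    rwa [hst.past_eq hs.isGlobalTrace ht.isGlobalTrace hv]
  have past_of_eq {t : Trace N X G M Ex Val} (ht : P.Traces t) (hv : v = t.sink) :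
      P.Traces (t.past v) := by
    rwa [hv, ht.isLocalTrace.past_sink]
  induction ht with
  | init t h =>
    refine past_of_eq (.init t h) ?_
    obtain ⟨σ, -, rfl⟩ := h
    exact hv
  | new t₀ t u₁ h₀ h ih =>
    rcases h.2.2.1 ▸ hv with hv | hv
    · exact past_of_eq (.new t₀ t u₁ h₀ h) hv
    · exact past_of_sub h₀ (.new t₀ t u₁ h₀ h) (sub_of_mem_new h) hv (ih hv)
  | edge t₀ t u A u' he hA h₀ h ih =>
    have ht : P.Traces t := .edge t₀ t u A u' he hA h₀ h
    rcases h.2.2.2.2.2.2.1 ▸ hv with hv | hv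
    · exact past_of_eq ht hv
    · exact past_of_sub h₀ ht (sub_of_mem_sem h) hv (ih hv)
  | lock t₀ t₁ t u a u' he h₀ h₁ h ih₀ ih₁ =>
    have ht : P.Traces t := .lock t₀ t₁ t u a u' he h₀ h₁ h
    rcases h.2.2.2.2.1 ▸ hv with hv | hv | hv
    · exact past_of_eq ht hv
    · exact past_of_sub h₀ ht (sub_left_of_mem_semLock h) hv (ih₀ hv)
    · exact past_of_sub h₁ ht (sub_right_of_mem_semLock h) hv (ih₁ hv)

lemma nodes_past_ssubset (ht : P.Traces t) {v : Node N X Val} (hv : v ∈ t.nodes)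
    (hne : v ≠ t.sink) : (t.past v).nodes ⊂ t.nodes :=
  ((t.past_sub v).nodes).ssubset_of_mem_notMem ht.isLocalTrace.sink_mem fun hs =>
    hne (ht.isGlobalTrace.le_antisymm (ht.isLocalTrace.sink_max v hv) hs.2)

theorem past_induction {motive : Trace N X G M Ex Val → Prop}
    (step : ∀ t, P.Traces t → (∀ v ∈ t.nodes, v ≠ t.sink → motive (t.past v)) → motive t)
    (ht : P.Traces t) : motive t := by
  induction hn : t.nodes.ncard using Nat.strong_induction_on generalizing t with
  | h n ih =>
    exact step t ht fun v hv hne => ih _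
      (hn ▸ Set.ncard_lt_ncard (ht.nodes_past_ssubset hv hne) ht.finite_nodes) (ht.past hv) rfl

end Traces

end Program

/-! ### The local trace semantics -/

lemma effect_le_iff {Un : Type u} {Dom : Un → Type u} [∀ x, CompleteLattice (Dom x)] {x : Un}
    {d : Dom x} {η : ∀ x, Dom x} : effect x d ≤ η ↔ d ≤ η x := by
  classical
  rw [effect, update_le_iff]
  exact and_iff_left fun _ _ => bot_le

namespace Program

/-- The local trace semantics: `[u]` holds the traces of `𝒯` that end at `u`, and `[a]` the initial
traces and the traces of `𝒯` whose last action is `unlock(a)`. -/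
def localTraceSemantics (P : Program N X G M Ex Val) : ∀ x, TraceDom N X G M Ex Val x
  | .pt u => {t | P.Traces t ∧ t.sink.pt = u}
  | .mx a => P.init ∪ {t | P.Traces t ∧ t.LastIs (.unlock a)}

lemma isPostSolution_localTraceSemantics (P : Program N X G M Ex Val) :
    IsPostSolution P.traceSystem P.localTraceSemantics := by
  have edge {u A u'} (he : (u, A, u') ∈ P.edges) (hA : ∀ a, A ≠ .lock a) :
      ⋃ t ∈ P.localTraceSemantics (.pt u), P.sem u A u' t ⊆ P.localTraceSemantics (.pt u') :=
    Set.iUnion₂_subset fun t₀ h₀ t ht => ⟨.edge t₀ t u A u' he hA h₀.1 ht, ht.2.2.2.1⟩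
  rintro c ((rfl | ⟨a, rfl⟩) | ⟨u, A, u', he, rfl⟩)
  · exact ⟨bot_le, by rintro t ⟨σ, hσ, rfl⟩; exact ⟨.init _ ⟨σ, hσ, rfl⟩, rfl⟩⟩
  · exact ⟨bot_le, Set.subset_union_left⟩
  · cases A with
    | create x u₁ =>
      refine ⟨effect_le_iff.2 (Set.iUnion₂_subset fun t₀ h₀ t ht => ?_), edge he nofun⟩
      exact ⟨.new t₀ t u₁ h₀.1 ht, congrArg Node.pt ht.2.1⟩
    | lock a =>
      refine ⟨bot_le, Set.iUnion₂_subset fun t₀ h₀ => Set.iUnion₂_subset fun t₁ h₁ t ht => ?_⟩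
      have ht₁ : P.Traces t₁ := h₁.elim (.init t₁) And.left
      exact ⟨.lock t₀ t₁ t u a u' he h₀.1 ht₁ ht, congrArg Node.pt ht.2.2.2.1⟩
    | unlock a =>
      refine ⟨effect_le_iff.2 (Set.iUnion₂_subset fun t₀ h₀ t ht => .inr ?_), edge he nofun⟩
      exact ⟨.edge t₀ t u _ u' he nofun h₀.1 ht, t₀.sink, act_of_mem_sem ht⟩
    | _ => exact ⟨bot_le, edge he nofun⟩

lemma init_subset_of_isPostSolution {η : ∀ x, TraceDom N X G M Ex Val x}
    (hη : IsPostSolution P.traceSystem η) (a : M) : P.init ⊆ η (.mx a) :=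
  (hη ⟨.mx a, fun _ => (⊥, P.init)⟩ (.inl (.inr ⟨a, rfl⟩))).2

lemma Traces.mem_of_isPostSolution {η : ∀ x, TraceDom N X G M Ex Val x}
    (hη : IsPostSolution P.traceSystem η) (ht : P.Traces t) :
    t ∈ η (.pt t.sink.pt) ∧ ∀ a, t.LastIs (.unlock a) → t ∈ η (.mx a) := by
  have sys {u A u'} (he : (u, A, u') ∈ P.edges) :
      (P.rhs u A u' η).1 ≤ η ∧ (P.rhs u A u' η).2 ≤ η (.pt u') :=
    hη ⟨.pt u', P.rhs u A u'⟩ (.inr ⟨u, A, u', he, rfl⟩)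
  induction ht with
  | init t h =>
    refine ⟨?_, ?_⟩
    · have hpt : t.sink.pt = P.start := by obtain ⟨σ, -, rfl⟩ := h; rfl
      exact hpt ▸ (hη _ (.inl (.inl rfl))).2 h
    · obtain ⟨σ, -, rfl⟩ := h
      rintro a ⟨_, e⟩
      exact e.elim
  | new t₀ t u₁ _ h ih =>
    obtain ⟨hloc, hsink, -, -, hcr, -⟩ := id h
    obtain ⟨-, -, hidx, -, ⟨x, v, he⟩, -⟩ := hloc.cr_dom _ _ ((hcr _ _).2 (.inr ⟨rfl, rfl⟩))
    have hpt : t.sink.pt = u₁ := congrArg Node.pt hsink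
    refine ⟨?_, fun a ⟨w, e⟩ => absurd (hidx ▸ hloc.idx_eq e) (by simp)⟩
    rw [hpt] at he ⊢
    exact effect_le_iff.1 (sys he).1 (Set.mem_iUnion₂_of_mem ih.1 h)
  | edge t₀ t u A u' he hA _ h ih =>
    obtain ⟨hloc, rfl, -, rfl, -⟩ := id h
    refine ⟨?_, fun a ⟨w, e⟩ => ?_⟩
    · cases A with
      | lock a => exact absurd rfl (hA a)
      | _ => exact (sys he).2 (Set.mem_iUnion₂_of_mem ih.1 h)
    · obtain ⟨-, rfl⟩ := hloc.eq_of_act_of_act_target (act_of_mem_sem h) e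
      exact effect_le_iff.1 (sys he).1 (Set.mem_iUnion₂_of_mem ih.1 h)
  | lock t₀ t₁ t u a u' he _ _ h ih₀ ih₁ =>
    obtain ⟨hloc, hlast, rfl, hsink, -⟩ := id h
    refine ⟨?_, fun b ⟨w, e⟩ => ?_⟩
    · have ht₁ : t₁ ∈ η (.mx a) :=
        hlast.elim (fun hi => init_subset_of_isPostSolution hη a hi) (ih₁.2 a)
      obtain rfl : t.sink.pt = u' := congrArg Node.pt hsink
      exact (sys he).2 (Set.mem_iUnion₂_of_mem ih₀.1 (Set.mem_iUnion₂_of_mem ht₁ h))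
    · exact absurd (hloc.eq_of_act_of_act_target (act_of_mem_semLock h) e).2 nofun

theorem isLeast_localTraceSemantics (P : Program N X G M Ex Val) :
    IsLeast {η | IsPostSolution P.traceSystem η} P.localTraceSemantics := by
  refine ⟨P.isPostSolution_localTraceSemantics, fun η hη => ?_⟩
  rintro (u | a) t ht
  · obtain ⟨ht, rfl⟩ := ht
    exact (ht.mem_of_isPostSolution hη).1
  · rcases ht with hi | ⟨ht, hlast⟩
    · exact init_subset_of_isPostSolution hη a hi
    · exact (ht.mem_of_isPostSolution hη).2 a hlast

end Program

/-! ### Critical sections -/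

namespace Program

variable {a : M} {p p' y y' z z' : Node N X Val}

/-- At the node `p`, its thread is in the critical section of `a` which it entered at `y`. -/
structure HeldSince (P : Program N X G M Ex Val) (t : Trace N X G M Ex Val) (a : M)
    (y p : Node N X Val) : Prop where
  lock : ∃ w, (w, Action.lock a, y) ∈ t.acts
  tid_eq : P.tid y = P.tid p
  idx_le : y.idx ≤ p.idx
  unlock_lt : ∀ z z', (z, Action.unlock a, z') ∈ t.acts → P.tid z' = P.tid p → z'.idx ≤ p.idx →
    z'.idx < y.idx

lemma mem_lockset_iff : a ∈ P.lockset t p ↔ ∃ y, P.HeldSince t a y p :=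
  ⟨fun ⟨w, y, e, hid, hidx, hlt⟩ => ⟨y, ⟨w, e⟩, hid, hidx, hlt⟩,
    fun ⟨y, ⟨w, e⟩, hid, hidx, hlt⟩ => ⟨w, y, e, hid, hidx, hlt⟩⟩

/-- The critical section of `a` entered at `y` is left by an `unlock(a)` edge ending in `z`. -/
def Closes (P : Program N X G M Ex Val) (t : Trace N X G M Ex Val) (a : M)
    (y z : Node N X Val) : Prop :=
  ∃ x, P.HeldSince t a y x ∧ (x, Action.unlock a, z) ∈ t.acts

lemma IsGlobalTrace.exists_closes (h : P.IsGlobalTrace t) {x : Node N X Val}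
    (e : (x, Action.unlock a, z) ∈ t.acts) : ∃ y, P.Closes t a y z := by
  obtain ⟨y, hy⟩ := mem_lockset_iff.1 (h.unlock_held a x z e)
  exact ⟨y, x, hy, e⟩

lemma Closes.mem (hz : P.Closes t a y z) (h : P.IsGlobalTrace t) : z ∈ t.nodes := by
  obtain ⟨x, -, e⟩ := hz
  exact h.target_mem e

lemma HeldSince.mem (hp : P.HeldSince t a y p) (h : P.IsGlobalTrace t) : y ∈ t.nodes := by
  obtain ⟨w, e⟩ := hp.lock
  exact h.target_mem e

lemma Closes.tid_eq (hz : P.Closes t a y z) (h : P.IsGlobalTrace t) : P.tid y = P.tid z := by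
  obtain ⟨x, hx, e⟩ := hz
  exact hx.tid_eq.trans (h.tid_eq e)

lemma HeldSince.le (hp : P.HeldSince t a y p) (h : P.IsGlobalTrace t) (hmem : p ∈ t.nodes) :
    t.Le y p :=
  h.le_of_idx_le (hp.mem h) hmem hp.tid_eq hp.idx_le

lemma HeldSince.idx_lt_of_closes (hp : P.HeldSince t a y p) (h : P.IsGlobalTrace t)
    (hz : P.Closes t a y z) : p.idx < z.idx := by
  have hid := hz.tid_eq h
  obtain ⟨x, hx, e⟩ := hz
  by_contra! hle
  have := hp.unlock_lt x z e (hid.symm.trans hp.tid_eq) hle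
  have := hx.idx_le
  have := h.idx_eq e
  omega

lemma HeldSince.le_of_closes (hp : P.HeldSince t a y p) (h : P.IsGlobalTrace t)
    (hz : P.Closes t a y z) {A : Action N X G M Ex} (e : (p, A, p') ∈ t.acts) :
    p'.idx ≤ z.idx ∧ t.Le p' z := by
  have hidx : p'.idx ≤ z.idx := h.idx_eq e ▸ hp.idx_lt_of_closes h hz
  have hid : P.tid p' = P.tid z := (h.tid_eq e).symm.trans (hp.tid_eq.symm.trans (hz.tid_eq h))
  exact ⟨hidx, h.le_of_idx_le (h.target_mem e) (hz.mem h) hid hidx⟩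

lemma Closes.le (hz : P.Closes t a y z) (h : P.IsGlobalTrace t) : t.Le y z := by
  obtain ⟨x, hx, e⟩ := hz
  exact (hx.le h (h.source_mem e)).trans (Trace.le_of_act e)

lemma Closes.unique (hz : P.Closes t a y z) (hz' : P.Closes t a y z') (h : P.IsGlobalTrace t) :
    z = z' := by
  have hid := (hz.tid_eq h).symm.trans (hz'.tid_eq h)
  obtain ⟨x, hx, e⟩ := id hz
  obtain ⟨x', hx', e'⟩ := id hz'
  exact h.eq_of_tid_eq_of_idx_eq (h.target_mem e) (h.target_mem e') hid
    (le_antisymm (hx.le_of_closes h hz' e).1 (hx'.le_of_closes h hz e').1)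

/-- In the locking order of `a`, the critical section entered at `y` is immediately followed by the
one entered at `y'`. -/
def NextSection (P : Program N X G M Ex Val) (t : Trace N X G M Ex Val) (a : M)
    (y y' : Node N X Val) : Prop :=
  ∃ z, P.Closes t a y z ∧ t.lk a z y'

lemma IsGlobalTrace.rightUnique_nextSection (h : P.IsGlobalTrace t) (a : M) :
    Relator.RightUnique (P.NextSection t a) := by
  rintro y y₁ y₂ ⟨z₁, hz₁, hlk₁⟩ ⟨z₂, hz₂, hlk₂⟩
  obtain rfl := hz₁.unique hz₂ h
  exact h.lk_succ a z₁ y₁ y₂ hlk₁ hlk₂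

lemma IsGlobalTrace.le_of_reflTransGen_nextSection (h : P.IsGlobalTrace t)
    (hyy' : Relation.ReflTransGen (P.NextSection t a) y y') : t.Le y y' := by
  induction hyy' with
  | refl => exact .refl
  | tail _ hnext ih =>
    obtain ⟨z, hz, hlk⟩ := hnext
    exact (ih.trans (hz.le h)).trans (Trace.le_of_lk hlk)

lemma IsGlobalTrace.exists_first_section (h : P.IsGlobalTrace t) (hfin : t.nodes.Finite)
    (hy : ∃ w, (w, Action.lock a, y) ∈ t.acts) :
    ∃ r y₀, P.IsRoot r ∧ t.lk a r y₀ ∧ Relation.ReflTransGen (P.NextSection t a) y₀ y := by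
  have : IsStrictOrder (Node N X Val) (Relation.TransGen t.Imm) :=
    { irrefl := h.acyclic, trans := fun _ _ _ => Relation.TransGen.trans }
  have wf := hfin.wellFoundedOn (r := Relation.TransGen t.Imm)
  have hmem : y ∈ t.nodes := hy.elim fun _ e => h.target_mem e
  revert hy
  apply wf.induction hmem
  rintro y - ih ⟨w, e⟩
  obtain ⟨z, hlk, -⟩ := h.lk_pred a w y e
  obtain ⟨-, hroot | ⟨x, ex⟩, -⟩ := h.lk_dom _ _ _ hlk
  · exact ⟨z, y, hroot, hlk, .refl⟩
  · obtain ⟨y', hclose⟩ := h.exists_closes ex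
    obtain ⟨x', hy', -⟩ := id hclose
    have hlt : Relation.TransGen t.Imm y' y :=
      .tail' (hclose.le h) (.inr (.inr ⟨a, hlk⟩))
    obtain ⟨r, y₀, hr, hlk₀, hy₀⟩ := ih y' (hy'.mem h) hlt hy'.lock
    exact ⟨r, y₀, hr, hlk₀, hy₀.tail ⟨z, hclose, hlk⟩⟩

lemma IsGlobalTrace.eq_or_closes_le_of_reflTransGen_nextSection (h : P.IsGlobalTrace t)
    (hyy' : Relation.ReflTransGen (P.NextSection t a) y y') :
    y = y' ∨ ∃ z, P.Closes t a y z ∧ t.Le z y' := by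
  rcases hyy'.cases_head with rfl | ⟨y₁, ⟨z, hz, hlk⟩, hy₁⟩
  · exact .inl rfl
  · exact .inr ⟨z, hz, (Trace.le_of_lk hlk).trans (h.le_of_reflTransGen_nextSection hy₁)⟩

theorem IsGlobalTrace.sections_total (h : P.IsGlobalTrace t) (hfin : t.nodes.Finite)
    (hy : ∃ w, (w, Action.lock a, y) ∈ t.acts) (hy' : ∃ w, (w, Action.lock a, y') ∈ t.acts) :
    y = y' ∨ (∃ z, P.Closes t a y z ∧ t.Le z y') ∨ ∃ z, P.Closes t a y' z ∧ t.Le z y := by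
  obtain ⟨r, y₀, hr, hlk, hy₀⟩ := h.exists_first_section hfin hy
  obtain ⟨r', y₀', hr', hlk', hy₀'⟩ := h.exists_first_section hfin hy'
  obtain rfl : r = r' := h.eq_of_tid_eq_of_idx_eq (h.lk_dom _ _ _ hlk).1 (h.lk_dom _ _ _ hlk').1
    (hr.2.2.trans hr'.2.2.symm) (hr.1.trans hr'.1.symm)
  obtain rfl := h.lk_succ a r y₀ y₀' hlk hlk'
  rcases Relation.ReflTransGen.total_of_right_unique (h.rightUnique_nextSection a) hy₀ hy₀' with
    hle | hle
  · exact (h.eq_or_closes_le_of_reflTransGen_nextSection hle).imp_right .inl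
  · exact (h.eq_or_closes_le_of_reflTransGen_nextSection hle).imp .symm .inr

/-! ### Accesses to globals -/

/-- Globals are only accessed while the mutex associated with them is held. -/
def AccessesProtected (P : Program N X G M Ex Val) (t : Trace N X G M Ex Val) : Prop :=
  ∀ v A v' g, (v, A, v') ∈ t.acts → A.Accesses g → P.mutexOf g ∈ P.lockset t v

lemma IsGlobalTrace.mem_lockset_of_lock (h : P.IsGlobalTrace t) {w : Node N X Val}
    (e : (w, Action.lock a, y) ∈ t.acts) : a ∈ P.lockset t y := by
  refine ⟨w, y, e, rfl, le_rfl, fun z z' ez hid hidx => hidx.lt_of_ne fun heq => ?_⟩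
  obtain rfl := h.eq_of_tid_eq_of_idx_eq (h.target_mem ez) (h.target_mem e) hid heq
  exact absurd (h.eq_of_act_of_act_target e ez).2 nofun

lemma AtomicAccesses.accessesProtected (hP : P.AtomicAccesses) (h : P.IsGlobalTrace t) :
    P.AccessesProtected t := by
  intro v A v' g e hA
  obtain ⟨hstart, hcreate, hlock, -⟩ := hP _ _ _ _ (h.edge_mem e) hA
  have hv := h.source_mem e
  have hidx : v.idx ≠ 0 := by
    intro h0
    obtain ⟨z, hz, -⟩ := h.cr_pred v hv h0 fun hroot => hstart hroot.2.1
    obtain ⟨-, -, -, -, ⟨x, z', he⟩, -⟩ := h.cr_dom _ _ hz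
    exact hcreate _ _ _ he
  obtain ⟨w, B, eB⟩ := h.exists_act_of_idx_ne_zero hv hidx
  obtain rfl := hlock _ _ (h.edge_mem eB)
  exact h.mem_lockset_of_lock eB

lemma IsGlobalTrace.accesses_total (h : P.IsGlobalTrace t) (hfin : t.nodes.Finite)
    (hprot : P.AccessesProtected t) {g : G} {v v' w w' : Node N X Val} {A B : Action N X G M Ex}
    (e : (v, A, v') ∈ t.acts) (hA : A.Accesses g) (e' : (w, B, w') ∈ t.acts)
    (hB : B.Accesses g) : t.Le v' w' ∨ t.Le w' v' := by
  have le_of_closes {v v' w w' y y' z : Node N X Val} {A B : Action N X G M Ex}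
      (e : (v, A, v') ∈ t.acts) (hv : P.HeldSince t (P.mutexOf g) y v)
      (e' : (w, B, w') ∈ t.acts) (hw : P.HeldSince t (P.mutexOf g) y' w)
      (hz : P.Closes t (P.mutexOf g) y z) (hzy' : t.Le z y') : t.Le v' w' :=
    ((hv.le_of_closes h hz e).2.trans hzy').trans
      ((hw.le h (h.source_mem e')).trans (Trace.le_of_act e'))
  obtain ⟨y, hv⟩ := mem_lockset_iff.1 (hprot v A v' g e hA)
  obtain ⟨y', hw⟩ := mem_lockset_iff.1 (hprot w B w' g e' hB)
  rcases h.sections_total hfin hv.lock hw.lock with rfl | ⟨z, hz, hle⟩ | ⟨z, hz, hle⟩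
  · have hid : P.tid v' = P.tid w' :=
      (h.tid_eq e).symm.trans (hv.tid_eq.symm.trans (hw.tid_eq.trans (h.tid_eq e')))
    exact (le_total v'.idx w'.idx).imp (h.le_of_idx_le (h.target_mem e) (h.target_mem e') hid)
      (h.le_of_idx_le (h.target_mem e') (h.target_mem e) hid.symm)
  · exact .inl (le_of_closes e hv e' hw hz hle)
  · exact .inr (le_of_closes e' hw e hv hz hle)

end Program

/-! ### Actions of the ego thread -/

namespace Program

/-- The program-order edges of the ego thread. -/
def egoActs (P : Program N X G M Ex Val) (t : Trace N X G M Ex Val) :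
    Set (Node N X Val × Action N X G M Ex × Node N X Val) :=
  {e | e ∈ t.acts ∧ P.tid e.2.2 = P.tid t.sink}

/-- `e` is the last program-order edge of the ego thread that is labelled by an action in `K`. -/
structure IsLastEgo (P : Program N X G M Ex Val) (t : Trace N X G M Ex Val)
    (K : Set (Action N X G M Ex)) (e : Node N X Val × Action N X G M Ex × Node N X Val) :
    Prop where
  mem : e ∈ P.egoActs t
  act_mem : e.2.1 ∈ K
  idx_le : ∀ e' ∈ P.egoActs t, e'.2.1 ∈ K → e'.2.2.idx ≤ e.2.2.idx

variable {K : Set (Action N X G M Ex)} {e e' : Node N X Val × Action N X G M Ex × Node N X Val}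
  {g : G} {a : M}

lemma isLastTlWrite_iff {w w' : Node N X Val} {y : X} :
    P.IsLastTlWrite t g w y w' ↔
      P.IsLastEgo t (Set.range (Action.write g)) (w, .write g y, w') := by
  refine ⟨fun ⟨e, hid, hmax⟩ => ⟨⟨e, hid⟩, ⟨y, rfl⟩, ?_⟩,
    fun h => ⟨h.mem.1, h.mem.2, fun z y' z' e hid => h.idx_le _ ⟨e, hid⟩ ⟨y', rfl⟩⟩⟩
  rintro ⟨z, _, z'⟩ ⟨ez, hz⟩ ⟨y', rfl⟩
  exact hmax z y' z' ez hz

lemma isLastTlLock_iff {w w' : Node N X Val} :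
    P.IsLastTlLock t a w w' ↔ P.IsLastEgo t {.lock a} (w, .lock a, w') := by
  refine ⟨fun ⟨e, hid, hmax⟩ => ⟨⟨e, hid⟩, rfl, ?_⟩,
    fun h => ⟨h.mem.1, h.mem.2, fun z z' e hid => h.idx_le _ ⟨e, hid⟩ rfl⟩⟩
  rintro ⟨z, _, z'⟩ ⟨ez, hz⟩ rfl
  exact hmax z z' ez hz

lemma IsLastEgo.unique (he : P.IsLastEgo t K e) (he' : P.IsLastEgo t K e')
    (h : P.IsGlobalTrace t) : e = e' := by
  obtain ⟨v, A, w⟩ := e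
  obtain ⟨v', A', w'⟩ := e'
  obtain rfl : w = w' := h.eq_of_tid_eq_of_idx_eq (h.target_mem he.mem.1) (h.target_mem he'.mem.1)
    (he.mem.2.trans he'.mem.2.symm)
    (le_antisymm (he'.idx_le _ he.mem he.act_mem) (he.idx_le _ he'.mem he'.act_mem))
  obtain ⟨rfl, rfl⟩ := h.eq_of_act_of_act_target he.mem.1 he'.mem.1
  rfl

lemma IsGlobalTrace.finite_acts (h : P.IsGlobalTrace t) (hfin : t.nodes.Finite) :
    t.acts.Finite := by
  refine .of_finite_image (f := fun e => e.2.2) (hfin.subset ?_) ?_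
  · rintro _ ⟨⟨v, A, w⟩, e, rfl⟩
    exact h.target_mem e
  · rintro ⟨v, A, w⟩ e ⟨v', A', _⟩ e' rfl
    obtain ⟨rfl, rfl⟩ := h.eq_of_act_of_act_target e e'
    rfl

lemma IsGlobalTrace.exists_isLastEgo (h : P.IsGlobalTrace t) (hfin : t.nodes.Finite)
    (he : e ∈ P.egoActs t) (hK : e.2.1 ∈ K) :
    ∃ e', P.IsLastEgo t K e' ∧ t.Le e.2.2 e'.2.2 := by
  obtain ⟨e', ⟨he', hK'⟩, hmax⟩ := Set.exists_max_image {e | e ∈ P.egoActs t ∧ e.2.1 ∈ K}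
    (fun e => e.2.2.idx) ((h.finite_acts hfin).subset fun e he => he.1.1) ⟨e, he, hK⟩
  exact ⟨e', ⟨he', hK', fun e₁ he₁ hK₁ => hmax e₁ ⟨he₁, hK₁⟩⟩,
    h.le_of_idx_le (h.target_mem he.1) (h.target_mem he'.1) (he.2.trans he'.2.symm)
      (hmax e ⟨he, hK⟩)⟩

lemma IsGlobalTrace.exists_isLastTlLock (h : P.IsGlobalTrace t) (hfin : t.nodes.Finite)
    {w y : Node N X Val} (e : (w, Action.lock a, y) ∈ t.acts) (hid : P.tid y = P.tid t.sink) :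
    ∃ p p', P.IsLastTlLock t a p p' ∧ t.Le y p' := by
  obtain ⟨⟨p, _, p'⟩, hlast, hle⟩ :=
    h.exists_isLastEgo (K := {.lock a}) hfin (e := (w, .lock a, y)) ⟨e, hid⟩ rfl
  obtain rfl := hlast.act_mem
  exact ⟨p, p', isLastTlLock_iff.2 hlast, hle⟩

lemma IsGlobalTrace.beta_locks_eq (h : P.IsGlobalTrace t) {p p' : Node N X Val}
    (hlast : P.IsLastTlLock t a p p') : (P.beta t).2.1 a = single (P.lockset t p) := by
  have : {B | ∃ v v', P.IsLastTlLock t a v v' ∧ B = P.lockset t v} = {P.lockset t p} := by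
    refine Set.eq_singleton_iff_unique_mem.2 ⟨⟨p, p', hlast, rfl⟩, ?_⟩
    rintro _ ⟨v, v', hv, rfl⟩
    have heq := (isLastTlLock_iff.1 hv).unique (isLastTlLock_iff.1 hlast) h
    rw [(Prod.mk.inj heq).1]
  simp only [beta, this, upperClosure_singleton, single]

/-! ### The origin of read values -/

lemma IsLocalTrace.le_of_act_sink (h : P.IsLocalTrace t) {v z : Node N X Val}
    {A : Action N X G M Ex} (e : (v, A, t.sink) ∈ t.acts) (hA : ∀ a, A ≠ .lock a)
    (hz : z ∈ t.nodes) (hne : z ≠ t.sink) : t.Le z v := by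
  rcases (h.sink_max z hz).cases_tail with heq | ⟨c, hzc, ⟨B, eB⟩ | hcr | ⟨b, hlk⟩⟩
  · exact absurd heq.symm hne
  · rwa [(h.eq_of_act_of_act_target e eB).1]
  · have := h.idx_eq e
    have := (h.cr_dom _ _ hcr).2.2.1
    omega
  · obtain ⟨-, -, q, eq⟩ := h.lk_dom _ _ _ hlk
    exact absurd (h.eq_of_act_of_act_target e eq).2 (hA b)

lemma IsLocalTrace.exists_isLastWrite_of_read (h : P.IsLocalTrace t) (hfin : t.nodes.Finite)
    (hprot : P.AccessesProtected t) {v : Node N X Val} {x : X}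
    (e : (v, Action.read x g, t.sink) ∈ t.acts) :
    ∃ w y w', t.IsLastWrite g w y w' ∧ t.Le w' v ∧ t.sink.st x = w.st y := by
  obtain ⟨w, y, w', ew, hle, hmax, hval⟩ := h.globals x g v t.sink e
  refine ⟨w, y, w', ⟨ew, fun z y' z' ez => ?_⟩, hle, hval⟩
  rcases h.accesses_total hfin hprot ew (.inr ⟨y, rfl⟩) ez (.inr ⟨y', rfl⟩) with hc | hc
  · have hne : z' ≠ t.sink := by
      rintro rfl
      exact absurd (h.eq_of_act_of_act_target e ez).2 nofun
    rw [hmax z y' z' ez (h.le_of_act_sink e nofun (h.target_mem ez) hne) hc]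
    exact .refl
  · exact hc

/-- At `f`, after `w'`, the thread of `w'` releases the mutex `a`, which the ego thread thereafter
acquires for the last time by the edge from `p` to `p'`. -/
structure Handover (P : Program N X G M Ex Val) (t : Trace N X G M Ex Val) (w' : Node N X Val)
    (a : M) (f p p' : Node N X Val) : Prop where
  unlock : ∃ z, (z, Action.unlock a, f) ∈ t.acts
  tid_eq : P.tid w' = P.tid f
  idx_le : w'.idx ≤ f.idx
  isLastTlLock : P.IsLastTlLock t a p p'
  le : t.Le f p'

namespace Handover

variable {w' f p p' : Node N X Val}

lemma mem (hf : P.Handover t w' a f p p') (h : P.IsGlobalTrace t) : f ∈ t.nodes := by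
  obtain ⟨z, e⟩ := hf.unlock
  exact h.target_mem e

lemma le_release (hf : P.Handover t w' a f p p') (h : P.IsGlobalTrace t) (hw' : w' ∈ t.nodes) :
    t.Le w' f :=
  h.le_of_idx_le hw' (hf.mem h) hf.tid_eq hf.idx_le

lemma tid_source_eq (hf : P.Handover t w' a f p p') (h : P.IsGlobalTrace t) :
    P.tid p = P.tid t.sink :=
  (h.tid_eq hf.isLastTlLock.1).trans hf.isLastTlLock.2.1

end Handover

lemma IsLocalTrace.exists_handover (h : P.IsLocalTrace t) (hfin : t.nodes.Finite)
    (hprot : P.AccessesProtected t) {v w w' : Node N X Val} {A B : Action N X G M Ex}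
    (e : (v, A, t.sink) ∈ t.acts) (hA : A.Accesses g) (ew : (w, B, w') ∈ t.acts)
    (hB : B.Accesses g) (hle : t.Le w' v) (hid : P.tid w' ≠ P.tid t.sink) :
    ∃ f p p', P.Handover t w' (P.mutexOf g) f p p' := by
  obtain ⟨y, hy⟩ := mem_lockset_iff.1 (hprot _ _ _ _ ew hB)
  obtain ⟨y', hy'⟩ := mem_lockset_iff.1 (hprot _ _ _ _ e hA)
  have hidw : P.tid y = P.tid w' := hy.tid_eq.trans (h.tid_eq ew)
  have hidv : P.tid y' = P.tid t.sink := hy'.tid_eq.trans (h.tid_eq e)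
  rcases h.sections_total hfin hy.lock hy'.lock with rfl | ⟨f, hf, hfy'⟩ | ⟨f, hf, hfy⟩
  · exact absurd (hidw.symm.trans hidv) hid
  · obtain ⟨q, eq⟩ := hy'.lock
    obtain ⟨p, p', hlast, hy'p'⟩ := h.exists_isLastTlLock hfin eq hidv
    obtain ⟨z, -, ez⟩ := id hf
    exact ⟨f, p, p', ⟨z, ez⟩, hidw.symm.trans (hf.tid_eq h.toIsGlobalTrace),
      (hy.le_of_closes h.toIsGlobalTrace hf ew).1, hlast, hfy'.trans hy'p'⟩
  · have hfv : t.Le f v :=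
      ((hfy.trans (hy.le h.toIsGlobalTrace (h.source_mem ew))).trans (Trace.le_of_act ew)).trans hle
    have hidf : P.tid f = P.tid v := (hf.tid_eq h.toIsGlobalTrace).symm.trans hy'.tid_eq
    exact absurd (h.idx_le_of_le (h.source_mem e) hidf hfv)
      (hy'.idx_lt_of_closes h.toIsGlobalTrace hf).not_ge

lemma Handover.exists_maximal {w' f p p' : Node N X Val} (hf : P.Handover t w' a f p p')
    (h : P.IsGlobalTrace t) (hfin : t.nodes.Finite) :
    ∃ a f p p', P.Handover t w' a f p p' ∧
      ∀ a' f' q q', P.Handover t w' a' f' q q' → f'.idx ≤ f.idx := by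
  obtain ⟨f, ⟨a, p, p', hf⟩, hmax⟩ :=
    Set.exists_max_image {f | ∃ a p p', P.Handover t w' a f p p'} Node.idx
      (hfin.subset fun f ⟨_, _, _, hf⟩ => hf.mem h) ⟨f, a, p, p', hf⟩
  exact ⟨a, f, p, p', hf, fun a' f' q q' hf' => hmax f' ⟨a', q, q', hf'⟩⟩

lemma Handover.disjoint_lockset {w' f p p' : Node N X Val} (hf : P.Handover t w' a f p p')
    (hmax : ∀ a' f' q q', P.Handover t w' a' f' q q' → f'.idx ≤ f.idx)
    (h : P.IsGlobalTrace t) (hfin : t.nodes.Finite) (hid : P.tid w' ≠ P.tid t.sink) :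
    P.lockset t p ∩ P.lockset t f = ∅ := by
  rw [Set.eq_empty_iff_forall_notMem]
  rintro c ⟨hcp, hcf⟩
  obtain ⟨y, hy⟩ := mem_lockset_iff.1 hcp
  obtain ⟨y', hy'⟩ := mem_lockset_iff.1 hcf
  have hidp := hf.tid_source_eq h
  rcases h.sections_total hfin hy'.lock hy.lock with rfl | ⟨z, hz, hzy⟩ | ⟨z, hz, hzy'⟩
  · exact hid (hf.tid_eq.trans (hy'.tid_eq.symm.trans (hy.tid_eq.trans hidp)))
  · -- the writer releases `c` after `f`, which yields a later handover
    obtain ⟨q, eq⟩ := hy.lock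
    obtain ⟨p₁, p₁', hlast, hyp₁'⟩ := h.exists_isLastTlLock hfin eq (hy.tid_eq.trans hidp)
    obtain ⟨x, -, ex⟩ := id hz
    have hlt := hy'.idx_lt_of_closes h hz
    have hidz : P.tid f = P.tid z := hy'.tid_eq.symm.trans (hz.tid_eq h)
    exact absurd (hmax c z p₁ p₁' ⟨⟨x, ex⟩, hf.tid_eq.trans hidz, hf.idx_le.trans hlt.le, hlast,
      hzy.trans hyp₁'⟩) hlt.not_ge
  · -- the ego thread releases `c` after `p'` and before `f`, which closes a causal cycle
    have hp'f : t.Le p' f := (((hy.le_of_closes h hz hf.isLastTlLock.1).2).trans hzy').trans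
      (hy'.le h (hf.mem h))
    have heq : f = p' := h.le_antisymm hf.le hp'f
    exact hid (hf.tid_eq.trans (heq ▸ hf.isLastTlLock.2.1))

lemma Handover.notMem_beta_written {w w' f p p' : Node N X Val} {y : X}
    (hf : P.Handover t w' a f p p') (h : P.IsGlobalTrace t) (hw : t.IsLastWrite g w y w')
    (hid : P.tid w' ≠ P.tid t.sink) : g ∉ OrderDual.ofDual ((P.beta t).1 a) := by
  rintro ⟨z, y', z', hz, hafter⟩
  have hw'z' : t.Le w' z' := ((hf.le_release h (h.target_mem hw.1)).trans hf.le).trans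
    (hafter p p' hf.isLastTlLock)
  have heq : w' = z' := h.le_antisymm hw'z' (hw.2 _ _ _ hz.1)
  exact hid (heq ▸ hz.2.1)

lemma IsGlobalTrace.idx_le_of_isLastWrite (h : P.IsGlobalTrace t) {w w' z z' : Node N X Val}
    {y y' : X} (hw : t.IsLastWrite g w y w') (ez : (z, Action.write g y', z') ∈ t.acts)
    (hid : P.tid z' = P.tid w') : z'.idx ≤ w'.idx :=
  h.idx_le_of_le (h.target_mem hw.1) hid (hw.2 z y' z' ez)

theorem Traces.read_origin (ht : P.Traces t) (hprot : P.AccessesProtected t) {x : X}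
    (hlast : t.LastIs (.read x g)) :
    ∃ w y w', t.IsLastWrite g w y w' ∧ t.sink.st x = w.st y ∧
      (P.IsLastTlWrite t g w y w' ∨
        ∃ a B, ∃ f ∈ t.nodes, f ≠ t.sink ∧ (t.past f).LastIs (.unlock a) ∧
          P.IsLastTlWrite (t.past f) g w y w' ∧ (P.beta t).2.1 a = single B ∧
          B ∩ P.lockset (t.past f) f = ∅ ∧ g ∉ OrderDual.ofDual ((P.beta t).1 a)) := by
  obtain ⟨v, e⟩ := hlast
  have h := ht.isGlobalTrace
  obtain ⟨w, y, w', hw, hle, hval⟩ :=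
    ht.isLocalTrace.exists_isLastWrite_of_read ht.finite_nodes hprot e
  refine ⟨w, y, w', hw, hval, ?_⟩
  by_cases hid : P.tid w' = P.tid t.sink
  · exact .inl ⟨hw.1, hid, fun z y' z' ez hz => h.idx_le_of_isLastWrite hw ez (hz.trans hid.symm)⟩
  right
  obtain ⟨_, _, _, hf₀⟩ := ht.isLocalTrace.exists_handover ht.finite_nodes hprot e
    (.inl ⟨x, rfl⟩) hw.1 (.inr ⟨y, rfl⟩) hle hid
  obtain ⟨a, f, p, p', hf, hmax⟩ := hf₀.exists_maximal h ht.finite_nodes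
  have hmem := hf.mem h
  have hpast := ht.past hmem
  obtain ⟨z, ez⟩ := hf.unlock
  refine ⟨a, P.lockset t p, f, hmem, ?_, ⟨z, ez, .refl⟩, ?_, h.beta_locks_eq hf.isLastTlLock, ?_,
    hf.notMem_beta_written h hw hid⟩
  · rintro rfl
    exact hid hf.tid_eq
  · exact ⟨⟨hw.1, hf.le_release h (h.target_mem hw.1)⟩, hf.tid_eq, fun z y' z' ez hz =>
      h.idx_le_of_isLastWrite hw ez.1 (hz.trans hf.tid_eq.symm)⟩
  · rw [← (t.past_sub f).lockset_eq (v := f) hpast.isGlobalTrace h hpast.isLocalTrace.sink_mem]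
    exact hf.disjoint_lockset hmax h ht.finite_nodes hid

end Program

/-! ### Extending a trace by an action of the ego thread -/

namespace Program

variable {t₀ t₁ : Trace N X G M Ex Val} {A : Action N X G M Ex} {u u' : N} {a : M} {g : G}

lemma IsLocalTrace.mem_lockset_sink_iff (h : P.IsLocalTrace t) :
    a ∈ P.lockset t t.sink ↔ ∃ e ∈ P.egoActs t, e.2.1 = .lock a ∧
      ∀ e' ∈ P.egoActs t, e'.2.1 = .unlock a → e'.2.2.idx < e.2.2.idx := by
  constructor
  · rintro ⟨w, w', e, hid, -, hlt⟩
    refine ⟨_, ⟨e, hid⟩, rfl, ?_⟩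
    rintro ⟨z, _, z'⟩ ⟨e', hid'⟩ rfl
    exact hlt z z' e' hid' (h.idx_le_sink (h.target_mem e') hid')
  · rintro ⟨⟨w, _, w'⟩, ⟨e, hid⟩, rfl, hlt⟩
    exact ⟨w, w', e, hid, h.idx_le_sink (h.target_mem e) hid,
      fun z z' e' hid' _ => hlt _ ⟨e', hid'⟩ rfl⟩

/-- The trace `t` arises from `t₀` by executing `A` at the sink of `t₀`, possibly after merging `t₀`
with another trace. -/
structure Extends (P : Program N X G M Ex Val) (t₀ : Trace N X G M Ex Val)
    (A : Action N X G M Ex) (t : Trace N X G M Ex Val) : Prop where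
  isLocalTrace₀ : P.IsLocalTrace t₀
  isLocalTrace : P.IsLocalTrace t
  sub : t₀.Sub t
  act : (t₀.sink, A, t.sink) ∈ t.acts
  create_val : ∀ x u₁, A = .create x u₁ → t.sink.st x = P.nu t₀

lemma extends_of_mem_sem (h₀ : P.IsLocalTrace t₀) (h : t ∈ P.sem u A u' t₀) :
    P.Extends t₀ A t :=
  ⟨h₀, h.1, sub_of_mem_sem h, act_of_mem_sem h, fun x u₁ hA => by
    classical exact (congrFun (h.2.2.2.2.2.1 x u₁ hA) x).trans (Function.update_self ..)⟩

lemma extends_of_mem_semLock (h₀ : P.IsLocalTrace t₀) (h : t ∈ P.semLock u a u' t₀ t₁) :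
    P.Extends t₀ (.lock a) t :=
  ⟨h₀, h.1, sub_left_of_mem_semLock h, act_of_mem_semLock h, nofun⟩

namespace Extends

lemma isGlobalTrace₀ (h : P.Extends t₀ A t) : P.IsGlobalTrace t₀ :=
  h.isLocalTrace₀.toIsGlobalTrace

lemma isGlobalTrace (h : P.Extends t₀ A t) : P.IsGlobalTrace t :=
  h.isLocalTrace.toIsGlobalTrace

lemma tid_sink (h : P.Extends t₀ A t) : P.tid t₀.sink = P.tid t.sink :=
  h.isGlobalTrace.tid_eq h.act

lemma idx_sink (h : P.Extends t₀ A t) : t.sink.idx = t₀.sink.idx + 1 :=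
  h.isGlobalTrace.idx_eq h.act

lemma step (h : P.Extends t₀ A t) : P.Step A t₀.sink.st t.sink.st :=
  h.isGlobalTrace.step h.act

lemma egoActs_eq (h : P.Extends t₀ A t) :
    P.egoActs t = insert (t₀.sink, A, t.sink) (P.egoActs t₀) := by
  ext ⟨w, B, w'⟩
  constructor
  · rintro ⟨e, hid⟩
    rcases (h.isLocalTrace.idx_le_sink (h.isGlobalTrace.target_mem e) hid).lt_or_eq with hlt | heq
    · have hid₀ := hid.trans h.tid_sink.symm
      have hle : w'.idx ≤ t₀.sink.idx := Nat.le_of_lt_succ (hlt.trans_eq h.idx_sink)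
      exact .inr ⟨(h.sub.act_mem_iff_of_idx_le h.isGlobalTrace₀ h.isGlobalTrace
        h.isLocalTrace₀.sink_mem hid₀ hle).1 e, hid₀⟩
    · obtain rfl := h.isGlobalTrace.eq_of_tid_eq_of_idx_eq (h.isGlobalTrace.target_mem e)
        h.isLocalTrace.sink_mem hid heq
      obtain ⟨rfl, rfl⟩ := h.isGlobalTrace.eq_of_act_of_act_target e h.act
      exact .inl rfl
  · rintro (heq | ⟨e, hid⟩)
    · exact heq ▸ ⟨h.act, rfl⟩
    · exact ⟨h.sub.acts e, hid.trans h.tid_sink⟩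

lemma mem_lockset_sink_iff_of_ne (h : P.Extends t₀ A t) (hlock : A ≠ .lock a)
    (hunlock : A ≠ .unlock a) : a ∈ P.lockset t t.sink ↔ a ∈ P.lockset t₀ t₀.sink := by
  simp only [h.isLocalTrace.mem_lockset_sink_iff, h.isLocalTrace₀.mem_lockset_sink_iff,
    h.egoActs_eq, Set.exists_mem_insert, Set.forall_mem_insert, hlock, hunlock, false_and,
    false_or, false_imp_iff, true_and]

lemma mem_lockset_sink_of_lock (h : P.Extends t₀ (.lock a) t) : a ∈ P.lockset t t.sink :=
  h.isGlobalTrace.mem_lockset_of_lock h.act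

lemma notMem_lockset_sink_of_unlock (h : P.Extends t₀ (.unlock a) t) :
    a ∉ P.lockset t t.sink := by
  rintro ⟨_, _, _, _, hle, hlt⟩
  exact (hlt _ _ h.act rfl le_rfl).not_ge hle

lemma lockset_sink (h : P.Extends t₀ A t) :
    P.lockset t t.sink = postLocks A (P.lockset t₀ t₀.sink) := by
  ext b
  cases A with
  | lock a =>
    obtain rfl | hb := eq_or_ne b a
    · exact iff_of_true h.mem_lockset_sink_of_lock (.inr rfl)
    · rw [h.mem_lockset_sink_iff_of_ne (by simpa using hb.symm) nofun]
      exact (or_iff_left hb).symm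
  | unlock a =>
    obtain rfl | hb := eq_or_ne b a
    · exact iff_of_false h.notMem_lockset_sink_of_unlock fun hc => hc.2 rfl
    · rw [h.mem_lockset_sink_iff_of_ne nofun (by simpa using hb.symm)]
      exact (and_iff_left hb).symm
  | _ => exact h.mem_lockset_sink_iff_of_ne nofun nofun

lemma isLastEgo_iff (h : P.Extends t₀ A t) {K : Set (Action N X G M Ex)} (hA : A ∉ K)
    {e : Node N X Val × Action N X G M Ex × Node N X Val} :
    P.IsLastEgo t K e ↔ P.IsLastEgo t₀ K e := by
  have mem_iff {e' : Node N X Val × Action N X G M Ex × Node N X Val} (he' : e'.2.1 ∈ K) :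
      e' ∈ P.egoActs t ↔ e' ∈ P.egoActs t₀ := by
    rw [h.egoActs_eq]
    refine or_iff_right ?_
    rintro rfl
    exact hA he'
  exact ⟨fun ⟨he, hK, hle⟩ =>
      ⟨(mem_iff hK).1 he, hK, fun e' he' hK' => hle e' ((mem_iff hK').2 he') hK'⟩,
    fun ⟨he, hK, hle⟩ =>
      ⟨(mem_iff hK).2 he, hK, fun e' he' hK' => hle e' ((mem_iff hK').1 he') hK'⟩⟩

lemma isLastEgo_sink (h : P.Extends t₀ A t) {K : Set (Action N X G M Ex)} (hA : A ∈ K) :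
    P.IsLastEgo t K (t₀.sink, A, t.sink) :=
  ⟨⟨h.act, rfl⟩, hA, fun _ he _ =>
    h.isLocalTrace.idx_le_sink (h.isGlobalTrace.target_mem he.1) he.2⟩

lemma isLastTlWrite_iff (h : P.Extends t₀ A t) (hA : ∀ x, A ≠ .write g x) {w w' : Node N X Val}
    {y : X} : P.IsLastTlWrite t g w y w' ↔ P.IsLastTlWrite t₀ g w y w' := by
  simp only [Program.isLastTlWrite_iff]
  refine h.isLastEgo_iff ?_
  rintro ⟨x, rfl⟩
  exact hA x rfl

lemma isLastTlLock_iff (h : P.Extends t₀ A t) (hA : A ≠ .lock a) {w w' : Node N X Val} :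
    P.IsLastTlLock t a w w' ↔ P.IsLastTlLock t₀ a w w' := by
  simp only [Program.isLastTlLock_iff]
  exact h.isLastEgo_iff hA

lemma isLastTlWrite_sink {x : X} (h : P.Extends t₀ (.write g x) t) :
    P.IsLastTlWrite t g t₀.sink x t.sink :=
  Program.isLastTlWrite_iff.2 (h.isLastEgo_sink ⟨x, rfl⟩)

lemma isLastTlLock_sink (h : P.Extends t₀ (.lock a) t) :
    P.IsLastTlLock t a t₀.sink t.sink :=
  Program.isLastTlLock_iff.2 (h.isLastEgo_sink rfl)

lemma mem_beta_written_of_write {x : X} (h : P.Extends t₀ (.write g x) t) (a : M) :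
    g ∈ OrderDual.ofDual ((P.beta t).1 a) :=
  ⟨_, _, _, h.isLastTlWrite_sink, fun _ _ hv =>
    h.isLocalTrace.sink_max _ (h.isGlobalTrace.target_mem hv.1)⟩

lemma beta_written_subset (h : P.Extends t₀ A t) (hA : A ≠ .lock a) :
    OrderDual.ofDual ((P.beta t₀).1 a) ⊆ OrderDual.ofDual ((P.beta t).1 a) := by
  rintro g ⟨w, y, w', hw, hafter⟩
  by_cases hg : ∃ x, A = .write g x
  · obtain ⟨x, rfl⟩ := hg
    exact h.mem_beta_written_of_write a
  · rw [not_exists] at hg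
    exact ⟨w, y, w', (h.isLastTlWrite_iff hg).2 hw,
      fun v v' hv => h.sub.le (hafter v v' ((h.isLastTlLock_iff hA).1 hv))⟩

lemma beta_locks_of_ne (h : P.Extends t₀ A t) (hA : A ≠ .lock a) :
    (P.beta t).2.1 a = (P.beta t₀).2.1 a := by
  have : {B | ∃ v v', P.IsLastTlLock t a v v' ∧ B = P.lockset t v} =
      {B | ∃ v v', P.IsLastTlLock t₀ a v v' ∧ B = P.lockset t₀ v} := by
    ext B
    simp only [h.isLastTlLock_iff hA, Set.mem_ofPred_eq]
    refine exists₂_congr fun v v' => and_congr_right fun hv => ?_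
    rw [h.sub.lockset_eq h.isGlobalTrace₀ h.isGlobalTrace (h.isGlobalTrace₀.source_mem hv.1)]
  exact congrArg (fun T => OrderDual.toDual (upperClosure T)) this

lemma beta_locks_of_lock (h : P.Extends t₀ (.lock a) t) :
    (P.beta t).2.1 a = single (P.lockset t₀ t₀.sink) := by
  rw [h.isGlobalTrace.beta_locks_eq h.isLastTlLock_sink,
    h.sub.lockset_eq h.isGlobalTrace₀ h.isGlobalTrace h.isLocalTrace₀.sink_mem]

lemma beta_global_of_ne (h : P.Extends t₀ A t) (hA : ∀ x, A ≠ .write g x) :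
    (P.beta t).2.2 (.inr g) = (P.beta t₀).2.2 (.inr g) := by
  ext d
  exact exists₃_congr fun w y w' => and_congr_left fun _ => h.isLastTlWrite_iff hA

lemma beta_global_of_write {x : X} (h : P.Extends t₀ (.write g x) t) :
    (P.beta t).2.2 (.inr g) ⊆ {t₀.sink.st x} := by
  rintro d ⟨w, y, w', hw, rfl⟩
  cases (Program.isLastTlWrite_iff.1 hw).unique
    (Program.isLastTlWrite_iff.1 h.isLastTlWrite_sink) h.isGlobalTrace
  rfl

end Extends

end Program

/-! ### Soundness of Lock-Centered Reading -/

variable {D : Type u} {𝒜 : Analysis N X G M Ex Val D} {u : N} {S : Set M} {s s' : State X G M D}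

lemma local_mem_of_mem_gammaPt (h : t ∈ gammaPt P 𝒜 u S s) (x : X) :
    t.sink.st x ∈ 𝒜.conc (s.2.2 (.inl x)) :=
  h.2.2.2.2.2 (.inl x) rfl

lemma global_subset_of_mem_gammaPt (h : t ∈ gammaPt P 𝒜 u S s) (g : G) :
    (P.beta t).2.2 (.inr g) ⊆ 𝒜.conc (s.2.2 (.inr g)) :=
  h.2.2.2.2.2 (.inr g)

open Classical in
lemma update_local_mem_of_mem_gammaPt (h : t ∈ gammaPt P 𝒜 u S s) {x : X} {v : Val} {d : D}
    (hv : v ∈ 𝒜.conc d) (z : X) :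
    Function.update t.sink.st x v z ∈ 𝒜.conc (Function.update s.2.2 (.inl x) d (.inl z)) := by
  obtain rfl | hz := eq_or_ne z x
  · simpa only [Function.update_self] using hv
  · rw [Function.update_of_ne hz, Function.update_of_ne (by simpa using hz)]
    exact local_mem_of_mem_gammaPt h z

lemma mem_conc_of_mem_gammaGl {a : M} {g : G} {d : D} {w w' : Node N X Val} {y : X}
    (h : t ∈ gammaGl P 𝒜 g a S d) (hw : P.IsLastTlWrite t g w y w') : w.st y ∈ 𝒜.conc d := by
  obtain ⟨ht, -, -, z, y', z', hz, hmem⟩ | ⟨-, -, -, hnone⟩ := h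
  · cases (Program.isLastTlWrite_iff.1 hw).unique (Program.isLastTlWrite_iff.1 hz)
      ht.isGlobalTrace
    exact hmem
  · exact absurd ⟨w, y, w', hw⟩ hnone

lemma mem_gammaPt_of_egoActs_eq_empty (ht : P.Traces t) (hego : P.egoActs t = ∅)
    {σ : X ⊕ G → D} (hσ : ∀ x, t.sink.st x ∈ 𝒜.conc (σ (.inl x))) :
    t ∈ gammaPt P 𝒜 t.sink.pt ∅
      (fun _ => OrderDual.toDual ∅, fun _ => OrderDual.toDual (upperClosure ∅), σ) := by
  have no_ego {w A w'} (e : (w, A, w') ∈ t.acts) (hid : P.tid w' = P.tid t.sink) : False :=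
    Set.eq_empty_iff_forall_notMem.1 hego (w, A, w') ⟨e, hid⟩
  refine ⟨ht, ?_, rfl, fun a => Set.empty_subset _, fun a => ?_, ?_⟩
  · exact Set.eq_empty_iff_forall_notMem.2 fun a ⟨w, w', e, hid, _⟩ => no_ego e hid
  · refine (congrArg (fun T => OrderDual.toDual (upperClosure T)) ?_).le
    exact Set.eq_empty_iff_forall_notMem.2 fun B ⟨v, v', hv, _⟩ => no_ego hv.1 hv.2.1
  · rintro (x | g)
    · rintro _ rfl
      exact hσ x
    · rintro d ⟨w, y, w', hw, -⟩
      exact (no_ego hw.1 hw.2.1).elim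

variable [CompleteLattice D] {t₀ : Trace N X G M Ex Val} {A : Action N X G M Ex} {u' u₁ : N}
  {η₂ : ∀ x, ADom N X G M D x}

lemma gammaPt_mono (hmono : Monotone 𝒜.conc) (hs : s ≤ s') :
    gammaPt P 𝒜 u S s ⊆ gammaPt P 𝒜 u S s' :=
  fun _ ⟨ht, hS, hpt, hV, hL, hσ⟩ =>
    ⟨ht, hS, hpt, hV.trans hs.1, hL.trans hs.2.1, fun z => (hσ z).trans (hmono (hs.2.2 z))⟩

lemma initState_le (hη₂ : IsPostSolution (lockCentered P 𝒜) η₂) :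
    initState ≤ η₂ (.pt P.start ∅) :=
  (hη₂ ⟨.pt P.start ∅, fun _ => (⊥, initState)⟩ (.inl rfl)).2

lemma arhs_le (hη₂ : IsPostSolution (lockCentered P 𝒜) η₂) (he : (u, A, u') ∈ P.edges)
    (S : Set M) : (arhs P 𝒜 u S A η₂).1 ≤ η₂ ∧
      (arhs P 𝒜 u S A η₂).2 ≤ η₂ (.pt u' (postLocks A S)) :=
  hη₂ ⟨.pt u' (postLocks A S), arhs P 𝒜 u S A⟩ (.inr ⟨u, A, u', S, he, rfl⟩)

/-- The trace `t` is described by `η₂` at the unknown of its sink and, if `t` ends with the release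
of a mutex `a`, at all unknowns `[g, a, S]` for the lockset `S` held at its sink. -/
structure IsSoundAt (P : Program N X G M Ex Val) (𝒜 : Analysis N X G M Ex Val D)
    (η₂ : ∀ x, ADom N X G M D x) (t : Trace N X G M Ex Val) : Prop where
  pt : t ∈ gammaPt P 𝒜 t.sink.pt (P.lockset t t.sink) (η₂ (.pt t.sink.pt (P.lockset t t.sink)))
  gl : ∀ a g, t.LastIs (.unlock a) →
    t ∈ gammaGl P 𝒜 g a (P.lockset t t.sink) (η₂ (.gl g a (P.lockset t t.sink)))

lemma isSoundAt_of_egoActs_eq_empty (hmono : Monotone 𝒜.conc) (ht : P.Traces t)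
    (hego : P.egoActs t = ∅) {σ : X ⊕ G → D} (hσ : ∀ x, t.sink.st x ∈ 𝒜.conc (σ (.inl x)))
    (hle : ((fun _ => OrderDual.toDual ∅, fun _ => OrderDual.toDual (upperClosure ∅), σ) :
      State X G M D) ≤ η₂ (.pt t.sink.pt ∅)) : IsSoundAt P 𝒜 η₂ t where
  pt := by
    have hmem := mem_gammaPt_of_egoActs_eq_empty (𝒜 := 𝒜) ht hego hσ
    have hS : P.lockset t t.sink = ∅ := hmem.2.1
    rw [hS]
    exact gammaPt_mono hmono hle hmem
  gl := by
    rintro a g ⟨v, e⟩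
    exact (Set.eq_empty_iff_forall_notMem.1 hego _ ⟨e, rfl⟩).elim

lemma isSoundAt_of_mem_init (h𝒜 : 𝒜.Sound P) (hη₂ : IsPostSolution (lockCentered P 𝒜) η₂)
    (h : t ∈ P.init) : IsSoundAt P 𝒜 η₂ t := by
  have ht : P.Traces t := .init t h
  obtain ⟨σ, -, rfl⟩ := h
  exact isSoundAt_of_egoActs_eq_empty h𝒜.conc_mono ht
    (Set.eq_empty_iff_forall_notMem.2 fun _ e => e.1)
    (fun x => h𝒜.conc_top.symm ▸ Set.mem_univ _) (initState_le hη₂)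

lemma isSoundAt_of_mem_new (h𝒜 : 𝒜.Sound P) (hη₂ : IsPostSolution (lockCentered P 𝒜) η₂)
    (ht : P.Traces t) (h : t ∈ P.new u₁ t₀) (h₀ : IsSoundAt P 𝒜 η₂ t₀) :
    IsSoundAt P 𝒜 η₂ t := by
  classical
  obtain ⟨hloc, hsink, -, -, hcr, -⟩ := id h
  obtain ⟨-, -, hidx, -, ⟨x, v, he⟩, -⟩ := hloc.cr_dom _ _ ((hcr _ _).2 (.inr ⟨rfl, rfl⟩))
  refine isSoundAt_of_egoActs_eq_empty h𝒜.conc_mono ht ?_ ?_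
    (effect_le_iff.1 (arhs_le hη₂ he (P.lockset t₀ t₀.sink)).1)
  · refine Set.eq_empty_iff_forall_notMem.2 fun ⟨w, A, w'⟩ ⟨e, hid⟩ => ?_
    have hle := hloc.idx_le_sink (hloc.target_mem e) hid
    rw [hidx, hloc.idx_eq e] at hle
    exact absurd hle (Nat.not_succ_le_zero _)
  · intro z
    rw [congrArg Node.st hsink]
    obtain rfl | hz := eq_or_ne z P.self
    · simpa only [Sum.elim_inl, Function.update_self] using h𝒜.nu _ _ _ _ _ _ _ he h₀.pt
    · simpa only [Sum.elim_inl, Function.update_of_ne hz] using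
        local_mem_of_mem_gammaPt h₀.pt z

namespace Program.Extends

lemma beta_written_le_arhs (h : P.Extends t₀ A t) (h₀ : t₀ ∈ gammaPt P 𝒜 u S (η₂ (.pt u S))) :
    (P.beta t).1 ≤ (arhs P 𝒜 u S A η₂).2.1 := by
  classical
  intro a
  have hV : A ≠ .lock a → (P.beta t).1 a ≤ (η₂ (.pt u S)).1 a :=
    fun hA g hg => h.beta_written_subset hA (h₀.2.2.2.1 a hg)
  cases A with
  | lock b =>
    obtain rfl | hab := eq_or_ne a b
    · simp only [arhs, Function.update_self]
      exact Set.empty_subset _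
    · simpa only [arhs, Function.update_of_ne hab] using hV (by simpa using hab.symm)
  | write g x =>
    exact Set.union_subset (hV nofun) (Set.singleton_subset_iff.2 (h.mem_beta_written_of_write a))
  | _ => exact hV nofun

lemma beta_locks_le_arhs (h : P.Extends t₀ A t) (h₀ : t₀ ∈ gammaPt P 𝒜 u S (η₂ (.pt u S))) :
    (P.beta t).2.1 ≤ (arhs P 𝒜 u S A η₂).2.2.1 := by
  classical
  intro a
  have hL : A ≠ .lock a → (P.beta t).2.1 a ≤ (η₂ (.pt u S)).2.1 a :=
    fun hA => (h.beta_locks_of_ne hA).trans_le (h₀.2.2.2.2.1 a)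
  cases A with
  | lock b =>
    obtain rfl | hab := eq_or_ne a b
    · have hS : P.lockset t₀ t₀.sink = S := h₀.2.1
      simp only [arhs, Function.update_self, h.beta_locks_of_lock, hS, le_refl]
    · simpa only [arhs, Function.update_of_ne hab] using hL (by simpa using hab.symm)
  | _ => exact hL nofun

lemma beta_global_subset_arhs (h𝒜 : 𝒜.Sound P) (h : P.Extends t₀ A t)
    (h₀ : t₀ ∈ gammaPt P 𝒜 u S (η₂ (.pt u S))) (g : G) :
    (P.beta t).2.2 (.inr g) ⊆ 𝒜.conc ((arhs P 𝒜 u S A η₂).2.2.2 (.inr g)) := by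
  have hg := global_subset_of_mem_gammaPt h₀ g
  cases A with
  | guard r =>
    rw [h.beta_global_of_ne nofun]
    exact (h𝒜.guard r _ (fun g => (P.beta t₀).2.2 (.inr g)) _ (local_mem_of_mem_gammaPt h₀)
      (global_subset_of_mem_gammaPt h₀) h.step.1).2 g
  | write g' x =>
    obtain rfl | hne := eq_or_ne g g'
    · simpa only [arhs, Function.update_self] using h.beta_global_of_write.trans
        (Set.singleton_subset_iff.2 (local_mem_of_mem_gammaPt h₀ x))
    · rw [h.beta_global_of_ne (by simpa using hne.symm)]
      simpa only [arhs, Function.update_of_ne (Sum.inr_injective.ne hne)] using hg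
  | lock a => rwa [h.beta_global_of_ne nofun]
  | unlock a => rwa [h.beta_global_of_ne nofun]
  | _ =>
    rw [h.beta_global_of_ne nofun]
    simpa only [arhs, Function.update_of_ne Sum.inr_ne_inl] using hg

lemma local_mem_arhs (h𝒜 : 𝒜.Sound P) (h : P.Extends t₀ A t) (he : (u, A, u') ∈ P.edges)
    (h₀ : t₀ ∈ gammaPt P 𝒜 u S (η₂ (.pt u S)))
    (hread : ∀ x g, A = .read x g →
      t.sink.st x ∈ 𝒜.conc ((arhs P 𝒜 u S A η₂).2.2.2 (.inl x))) (z : X) :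
    t.sink.st z ∈ 𝒜.conc ((arhs P 𝒜 u S A η₂).2.2.2 (.inl z)) := by
  classical
  have hz := local_mem_of_mem_gammaPt h₀ z
  have hstep := h.step
  cases A with
  | guard r =>
    obtain ⟨htrue, hst⟩ := hstep
    rw [hst]
    exact (h𝒜.guard r _ (fun g => (P.beta t₀).2.2 (.inr g)) _ (local_mem_of_mem_gammaPt h₀)
      (global_subset_of_mem_gammaPt h₀) htrue).1 z
  | assign x r =>
    rw [show t.sink.st = _ from hstep]
    exact update_local_mem_of_mem_gammaPt h₀
      (h𝒜.eval r _ _ (local_mem_of_mem_gammaPt h₀)) z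
  | create x u₁ =>
    obtain ⟨i, -, hst⟩ := hstep
    have hi := h.create_val x u₁ rfl
    rw [hst, Function.update_self] at hi
    rw [hst, hi]
    exact update_local_mem_of_mem_gammaPt h₀ (h𝒜.nu _ _ _ _ _ _ _ he h₀) z
  | read x g =>
    obtain ⟨d, hst⟩ := hstep
    have hd := hread x g rfl
    rw [hst, Function.update_self] at hd
    rw [hst]
    simp only [arhs, Function.update_self] at hd
    exact update_local_mem_of_mem_gammaPt h₀ hd z
  | lock a => rwa [show t.sink.st = _ from hstep]
  | unlock a => rwa [show t.sink.st = _ from hstep]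
  | write g x =>
    rw [show t.sink.st = _ from hstep]
    simpa only [arhs, Function.update_of_ne Sum.inl_ne_inr] using hz

lemma read_value_mem_arhs (hmono : Monotone 𝒜.conc) {x : X} {g : G}
    (h : P.Extends t₀ (.read x g) t) (ht : P.Traces t) (hprot : P.AccessesProtected t)
    (h₀ : t₀ ∈ gammaPt P 𝒜 u S (η₂ (.pt u S)))
    (ih : ∀ f ∈ t.nodes, f ≠ t.sink → IsSoundAt P 𝒜 η₂ (t.past f)) :
    t.sink.st x ∈ 𝒜.conc ((arhs P 𝒜 u S (.read x g) η₂).2.2.2 (.inl x)) := by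
  obtain ⟨w, y, w', -, hval, horigin⟩ := ht.read_origin hprot ⟨_, h.act⟩
  rw [hval]
  simp only [arhs, Function.update_self]
  rcases horigin with hw | ⟨a, B, f, hf, hne, hlast, hw, hB, hdisj, hg⟩
  · exact hmono le_sup_left (global_subset_of_mem_gammaPt h₀ g
      ⟨w, y, w', (h.isLastTlWrite_iff nofun).1 hw, rfl⟩)
  · have hwritten : g ∉ OrderDual.ofDual ((η₂ (.pt u S)).1 a) :=
      fun hc => hg (h.beta_written_subset nofun (h₀.2.2.2.1 a hc))
    have hlocks : B ∈ OrderDual.ofDual ((η₂ (.pt u S)).2.1 a) := by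
      have hle := h₀.2.2.2.2.1 a
      rw [← h.beta_locks_of_ne nofun, hB] at hle
      exact hle (UpperSet.mem_Ici_iff.2 le_rfl)
    refine hmono ((le_sSup ?_).trans le_sup_right)
      (mem_conc_of_mem_gammaGl ((ih f hf hne).gl a g hlast) hw)
    exact ⟨a, _, B, hwritten, hlocks, hdisj, rfl⟩

lemma mem_gammaGl_of_unlock (hmono : Monotone 𝒜.conc)
    (hη₂ : IsPostSolution (lockCentered P 𝒜) η₂) {a : M} (h : P.Extends t₀ (.unlock a) t)
    (ht : P.Traces t) (he : (u, .unlock a, u') ∈ P.edges)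
    (h₀ : t₀ ∈ gammaPt P 𝒜 u S (η₂ (.pt u S))) (g : G) :
    t ∈ gammaGl P 𝒜 g a (S \ {a}) (η₂ (.gl g a (S \ {a}))) := by
  have hS : P.lockset t t.sink = S \ {a} := by
    have hS₀ : P.lockset t₀ t₀.sink = S := h₀.2.1
    rw [h.lockset_sink, hS₀]
    rfl
  by_cases hw : ∃ w y w', P.IsLastTlWrite t g w y w'
  · obtain ⟨w, y, w', hw⟩ := hw
    refine .inl ⟨ht, hS, ⟨_, h.act⟩, w, y, w', hw, ?_⟩
    have hle := (arhs_le hη₂ he S).1 (.gl g a (S \ {a}))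
    simp only [arhs, and_self, if_true] at hle
    exact hmono hle (global_subset_of_mem_gammaPt h₀ g
      ⟨w, y, w', (h.isLastTlWrite_iff nofun).1 hw, rfl⟩)
  · exact .inr ⟨ht, hS, ⟨_, h.act⟩, hw⟩

lemma isSoundAt (h𝒜 : 𝒜.Sound P) (hη₂ : IsPostSolution (lockCentered P 𝒜) η₂)
    (h : P.Extends t₀ A t) (ht : P.Traces t) (hprot : P.AccessesProtected t)
    (ih : ∀ f ∈ t.nodes, f ≠ t.sink → IsSoundAt P 𝒜 η₂ (t.past f)) :
    IsSoundAt P 𝒜 η₂ t := by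
  have he := h.isGlobalTrace.edge_mem h.act
  have h₀ : IsSoundAt P 𝒜 η₂ t₀ := by
    rw [← h.sub.past_sink h.isLocalTrace₀ h.isGlobalTrace]
    exact ih _ (h.isGlobalTrace.source_mem h.act)
      (h.isGlobalTrace.ne_of_imm (.inl ⟨A, h.act⟩))
  refine ⟨?_, ?_⟩
  · refine gammaPt_mono h𝒜.conc_mono (h.lockset_sink ▸ (arhs_le hη₂ he _).2)
      ⟨ht, rfl, rfl, h.beta_written_le_arhs h₀.pt, h.beta_locks_le_arhs h₀.pt, ?_⟩
    rintro (x | g)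
    · rintro _ rfl
      refine h.local_mem_arhs h𝒜 he h₀.pt ?_ x
      rintro x g rfl
      exact h.read_value_mem_arhs h𝒜.conc_mono ht hprot h₀.pt ih
    · exact h.beta_global_subset_arhs h𝒜 h₀.pt g
  · rintro a g ⟨v, e⟩
    obtain ⟨rfl, rfl⟩ := h.isGlobalTrace.eq_of_act_of_act_target e h.act
    rw [h.lockset_sink]
    exact h.mem_gammaGl_of_unlock h𝒜.conc_mono hη₂ ht he h₀.pt g

end Program.Extends

theorem Program.Traces.isSoundAt (hprot : ∀ t, P.Traces t → P.AccessesProtected t)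
    (h𝒜 : 𝒜.Sound P) (hη₂ : IsPostSolution (lockCentered P 𝒜) η₂) (ht : P.Traces t) :
    IsSoundAt P 𝒜 η₂ t := by
  refine ht.past_induction fun t ht ih => ?_
  cases id ht with
  | init _ h => exact isSoundAt_of_mem_init h𝒜 hη₂ h
  | new t₀ _ u₁ h₀ h =>
    refine isSoundAt_of_mem_new h𝒜 hη₂ ht h ?_
    have hsub := sub_of_mem_new h
    rw [← hsub.past_sink h₀.isLocalTrace ht.isGlobalTrace]
    exact ih _ (hsub.nodes h₀.isLocalTrace.sink_mem)
      (ht.isGlobalTrace.ne_of_imm (imm_of_mem_new h))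
  | edge t₀ _ u A u' he hA h₀ h =>
    exact (extends_of_mem_sem h₀.isLocalTrace h).isSoundAt h𝒜 hη₂ ht (hprot _ ht) ih
  | lock t₀ t₁ _ u a u' he h₀ h₁ h =>
    exact (extends_of_mem_semLock h₀.isLocalTrace h).isSoundAt h𝒜 hη₂ ht (hprot _ ht) ih

end LockCentered

theorem theorem5_general {N X G M Ex Val D : Type u} [CompleteLattice D]
    (P : Program N X G M Ex Val) (hprot : ∀ t, P.Traces t → P.AccessesProtected t)
    (𝒜 : Analysis N X G M Ex Val D) (h𝒜 : 𝒜.Sound P) :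
    ∃ η : ∀ x, TraceDom N X G M Ex Val x, IsLeast {η | IsPostSolution P.traceSystem η} η ∧
      (∀ η₂ : ∀ x, ADom N X G M D x, IsPostSolution (lockCentered P 𝒜) η₂ →
        (∀ u S, η (.pt u) ∩ P.withLocks S ⊆ gammaPt P 𝒜 u S (η₂ (.pt u S))) ∧
        (∀ g a S, η (.mx a) ∩ P.withLocks S ⊆
          P.init ∪ gammaGl P 𝒜 g a S (η₂ (.gl g a S)))) ∧
      (∀ u x g, ∀ t ∈ η (.pt u), t.LastIs (.read x g) →
        ∃ w y w', t.IsLastWrite g w y w' ∧ t.sink.st x = w.st y ∧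
          (P.IsLastTlWrite t g w y w' ∨
            ∃ a B S', ∃ t' ∈ η (.mx a) ∩ P.withLocks S', P.IsLastTlWrite t' g w y w' ∧
              (P.beta t).2.1 a = single B ∧ B ∩ S' = ∅ ∧
              g ∉ OrderDual.ofDual ((P.beta t).1 a))) := by
  refine ⟨P.localTraceSemantics, P.isLeast_localTraceSemantics,
    fun η₂ hη₂ => ⟨?_, ?_⟩, ?_⟩
  · rintro u _ t ⟨⟨ht, rfl⟩, rfl⟩
    exact (ht.isSoundAt hprot h𝒜 hη₂).pt
  · rintro g a _ t ⟨hinit | ⟨ht, hlast⟩, rfl⟩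
    · exact .inl hinit
    · exact .inr ((ht.isSoundAt hprot h𝒜 hη₂).gl a g hlast)
  · rintro u x g t ⟨ht, -⟩ hlast
    obtain ⟨w, y, w', hw, hval, horigin⟩ := ht.read_origin (hprot t ht) hlast
    refine ⟨w, y, w', hw, hval, horigin.imp_right ?_⟩
    rintro ⟨a, B, f, hf, -, hunlock, hwf, hB, hdisj, hg⟩
    exact ⟨a, B, _, t.past f, ⟨.inr ⟨ht.past hf, hunlock⟩, rfl⟩, hwf, hB, hdisj, hg⟩

theorem theorem5 {N X G M Ex Val D : Type u} [CompleteLattice D]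
    (P : Program N X G M Ex Val) (hP : P.AtomicAccesses)
    (𝒜 : Analysis N X G M Ex Val D) (h𝒜 : 𝒜.Sound P) :
    -- the local trace semantics: the least solution of the concrete constraint system
    ∃ η : ∀ x, TraceDom N X G M Ex Val x, IsLeast {η | IsPostSolution P.traceSystem η} η ∧
      -- soundness of every post-solution of Lock-Centered Reading
      (∀ η₂ : ∀ x, ADom N X G M D x, IsPostSolution (lockCentered P 𝒜) η₂ →
        (∀ u S, η (.pt u) ∩ P.withLocks S ⊆ gammaPt P 𝒜 u S (η₂ (.pt u S))) ∧
        (∀ g a S, η (.mx a) ∩ P.withLocks S ⊆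
          P.init ∪ gammaGl P 𝒜 g a S (η₂ (.gl g a S)))) ∧
      -- origin of the values read from globals
      (∀ u x g, ∀ t ∈ η (.pt u), t.LastIs (.read x g) →
        ∃ w y w', t.IsLastWrite g w y w' ∧ t.sink.st x = w.st y ∧
          (P.IsLastTlWrite t g w y w' ∨
            ∃ a B S', ∃ t' ∈ η (.mx a) ∩ P.withLocks S', P.IsLastTlWrite t' g w y w' ∧
              (P.beta t).2.1 a = single B ∧ B ∩ S' = ∅ ∧
              g ∉ OrderDual.ofDual ((P.beta t).1 a))) :=
  theorem5_general P (fun _ ht => hP.accessesProtected ht.isGlobalTrace) 𝒜 h𝒜
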